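/- Let $d\ge 2$ and let $A,\tilde A\in L^2_{\rm loc}(\mathbb R^d;\mathbb R^d)$ be real magnetic potentials. Let $H_0=-\Delta$, and let $H=(i\nabla+A(x))^2$ and $\tilde H=(i\nabla+\tilde A(x))^2$ be the self-adjoint operators in $L_2(\mathbb R^d)$ associated with the closed quadratic forms $\|(i\nabla+A)u\|^2$ and $\|(i\nabla+\tilde A)u\|^2$, whose form domains consist of all $u\in L_2(\mathbb R^d)$ with $(i\nabla+A)u\in L_2$, respectively $(i\nabla+\tilde A)u\in L_2$, in the sense of distributions. For $K=H,\tilde H$ put, when the strong limits exist, $$W_\pm(K,H_0)=\operatorname*{s-lim}_{t\to\pm\infty}e^{iKt}e^{-iH_0t},\qquad \mathbf S(K,H_0)=W_+(K,H_0)^*\,W_-(K,H_0).$$ Let $$(Ff)(\lambda;\omega)=2^{-1/2}\lambda^{(d-2)/4}\hat f(\lambda^{1/2}\omega),\qquad \lambda>0,\ \omega\in\mathbb S^{d-1},$$ where $\hat f$ is the unitary Fourier transform of $f\in L_2(\mathbb R^d)$. A scattering matrix of the pair $H_0,K$ is a family of bounded operators $S(\lambda)$, $\lambda>0$, in $L_2(\mathbb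 S^{d-1})$ such that, for every $f\in L_2(\mathbb R^d)$, $(F\,\mathbf S(K,H_0)f)(\lambda)=S(\lambda)(Ff)(\lambda)$ for almost every $\lambda>0$. Suppose that the wave operators $W_\pm(H,H_0)$ exist, that $\operatorname{curl}A=\operatorname{curl}\tilde A$ in the sense of distributions, that is, $\partial_jA_k-\partial_kA_j=\partial_j\tilde A_k-\partial_k\tilde A_j$ for all $j,k$, and that for some $\rho>1$ $$\tilde A(x)-A(x)=O(|x|^{-\rho}),\qquad |x|\to\infty .$$ Then the wave operators $W_\pm(\tilde H,H_0)$ also exist, and the scattering operators and the scattering matrices for the pairs $H_0,H$ and $H_0,\tilde H$ coincide: $\mathbf S(\tilde H,H_0)=\mathbf S(H,H_0)$; a family $S(\lambda)$ is a scattering matrix of the pair $H_0,H$ if and only if it is one of the pair $H_0,\tilde H$; and if $S(\lambda)$ and $\tilde S(\lambda)$ are scattering matrices of the pairs $H_0,H$ and $H_0,\tilde H$, then $\tilde S(\lambda)=S(\lambda)$ for almost every $\lambda>0$. -/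

import Mathlib

open MeasureTheory Filter Topology
open scoped ContDiff InnerProductSpace FourierTransform

namespace MagneticScattering

noncomputable section

/-- Euclidean space `ℝ^d`. -/
abbrev Space (d : ℕ) : Type := EuclideanSpace ℝ (Fin d)

/-- The complex Hilbert space `L²(ℝ^d)`. -/
abbrev L2 (d : ℕ) : Type := Lp ℂ 2 (volume : Measure (Space d))

/-- The complex Hilbert space `L²(𝕊^{d-1})` for the surface measure of the unit sphere. -/
abbrev L2Sphere (d : ℕ) : Type := Lp ℂ 2 (volume : Measure (Space d)).toSphere

/-- Real test functions: smooth functions on `ℝ^d` with compact support. -/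
def IsTest {d : ℕ} (φ : Space d → ℝ) : Prop :=
  ContDiff ℝ ∞ φ ∧ HasCompactSupport φ

/-- The `j`-th partial derivative. -/
def partialDeriv {d : ℕ} (j : Fin d) (φ : Space d → ℝ) (x : Space d) : ℝ :=
  fderiv ℝ φ x (EuclideanSpace.single j 1)

/-! ### Magnetic potentials and Hamiltonians -/

/-- `A ∈ L²_loc(ℝ^d; ℝ^d)`. -/
def LocallySquareIntegrable {d : ℕ} (A : Space d → Space d) : Prop :=
  ∀ K : Set (Space d), IsCompact K → MemLp A 2 (volume.restrict K)

/-- `curl A = curl A'` in the sense of distributions: for all `j, k`,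
`∂_j A_k - ∂_k A_j = ∂_j A'_k - ∂_k A'_j`. -/
def SameCurl {d : ℕ} (A A' : Space d → Space d) : Prop :=
  ∀ (j k : Fin d) (φ : Space d → ℝ), IsTest φ →
    ∫ x, (A x k * partialDeriv j φ x - A x j * partialDeriv k φ x) =
      ∫ x, (A' x k * partialDeriv j φ x - A' x j * partialDeriv k φ x)

/-- `(i∇ + A) u = g` in the sense of distributions, where `u` and all the components
`g_j` belong to `L²(ℝ^d)`. -/
def HasMagneticGradient {d : ℕ} (A : Space d → Space d) (u : L2 d) (g : Fin d → L2 d) : Prop :=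
  ∀ (j : Fin d) (φ : Space d → ℝ), IsTest φ →
    ∫ x, g j x * (φ x : ℂ) =
      ∫ x, (-(Complex.I * u x * (partialDeriv j φ x : ℂ)) + (A x j : ℂ) * u x * (φ x : ℂ))

/-- The graph of the operator `H = (i∇ + A)²`: `u ∈ D(H)` and `H u = f`.  The operator is the one
associated with the closed quadratic form `‖(i∇ + A) u‖²`, whose form domain consists of all
`u ∈ L²` with `(i∇ + A) u ∈ L²`. -/
def magneticHamiltonian {d : ℕ} (A : Space d → Space d) (u f : L2 d) : Prop :=
  ∃ g : Fin d → L2 d, HasMagneticGradient A u g ∧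
    ∀ (v : L2 d) (k : Fin d → L2 d), HasMagneticGradient A v k →
      ∑ j, ⟪k j, g j⟫_ℂ = ⟪v, f⟫_ℂ

/-- The graph of the free operator `H₀ = -Δ`: `u, f ∈ L²` and `-Δ u = f` in the sense of
distributions. -/
def freeHamiltonian (d : ℕ) (u f : L2 d) : Prop :=
  ∀ φ : Space d → ℝ, IsTest φ →
    ∫ x, f x * (φ x : ℂ) = -∫ x, u x * (Laplacian.laplacian φ x : ℂ)

/-! ### Unitary groups and wave operators -/

section Abstract

variable {X : Type*} [NormedAddCommGroup X] [InnerProductSpace ℂ X] [CompleteSpace X]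

/-- `U t = e^{iHt}`: `U` is the strongly continuous one-parameter group of unitary operators with
infinitesimal generator `iH`, where the operator `H` is given by its graph: `u ∈ D(H)` and
`H u = f` if and only if `t ↦ U t u` is differentiable at `0` with derivative `i f`. -/
structure IsUnitaryGroupOf (H : X → X → Prop) (U : ℝ → X →L[ℂ] X) : Prop where
  mem_unitary : ∀ t, U t ∈ unitary (X →L[ℂ] X)
  map_zero : U 0 = 1
  map_add : ∀ s t, U (s + t) = U s * U t
  continuous : ∀ u, Continuous fun t => U t u
  generator : ∀ u f, H u f ↔ HasDerivAt (fun t => U t u) (Complex.I • f) 0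

/-- `W = s-lim e^{iHt} e^{-iH₀t}` along `l`: `W` is the wave operator `W₊(H, H₀)` if `l = atTop`
(that is `t → +∞`) and the wave operator `W₋(H, H₀)` if `l = atBot` (that is `t → -∞`). -/
def IsWaveOperator (l : Filter ℝ) (H H₀ : X → X → Prop) (W : X →L[ℂ] X) : Prop :=
  ∃ U U₀ : ℝ → X →L[ℂ] X, IsUnitaryGroupOf H U ∧ IsUnitaryGroupOf H₀ U₀ ∧
    ∀ f : X, Tendsto (fun t => U t (U₀ (-t) f)) l (𝓝 (W f))

/-- The wave operators `W₊(H, H₀)` and `W₋(H, H₀)` both exist. -/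
def WaveOperatorsExist (H H₀ : X → X → Prop) : Prop :=
  (∃ W, IsWaveOperator atTop H H₀ W) ∧ ∃ W, IsWaveOperator atBot H H₀ W

/-- `S = W₊* W₋` is the scattering operator for the pair `H₀`, `H`. -/
def IsScatteringOperator (H H₀ : X → X → Prop) (S : X →L[ℂ] X) : Prop :=
  ∃ Wp Wm : X →L[ℂ] X, IsWaveOperator atTop H H₀ Wp ∧ IsWaveOperator atBot H H₀ Wm ∧
    S = ContinuousLinearMap.adjoint Wp * Wm

end Abstract

/-! ### Scattering matrices -/

/-- The unitary Fourier transform `f̂(ξ) = (2π)^{-d/2} ∫ e^{-i⟨x, ξ⟩} f(x) dx` on `L²(ℝ^d)`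
(as a function defined almost everywhere), expressed through
`(𝓕 f)(ξ) = ∫ e^{-2πi⟨x, ξ⟩} f(x) dx`. -/
def fourierHat {d : ℕ} (f : L2 d) (ξ : Space d) : ℂ :=
  (((2 * Real.pi) ^ (-(d : ℝ) / 2) : ℝ) : ℂ) * (𝓕 f : L2 d) ((2 * Real.pi)⁻¹ • ξ)

/-- `(F f)(E; θ) = 2^{-1/2} E^{(d-2)/4} f̂(E^{1/2} θ)` for the energy `E > 0` and `θ ∈ 𝕊^{d-1}`.
For each `f`, this is an element of `L²(𝕊^{d-1})`, well defined for almost every `E > 0`. -/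
def energyShell {d : ℕ} (f : L2 d) (E : ℝ) (θ : Metric.sphere (0 : Space d) 1) : ℂ :=
  (((2 : ℝ) ^ (-(1 / 2) : ℝ) * E ^ (((d : ℝ) - 2) / 4) : ℝ) : ℂ) *
    fourierHat f (Real.sqrt E • (θ : Space d))

/-- `M(E)`, `E > 0`, is the scattering matrix for the pair `H₀ = -Δ`, `H`: for the scattering
operator `S` and all `f ∈ L²(ℝ^d)` one has `(F S f)(E) = M(E) (F f)(E)` for almost every `E > 0`. -/
def IsScatteringMatrix {d : ℕ} (H : L2 d → L2 d → Prop)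
    (M : ℝ → L2Sphere d →L[ℂ] L2Sphere d) : Prop :=
  ∃ S : L2 d →L[ℂ] L2 d, IsScatteringOperator H (freeHamiltonian d) S ∧
    ∀ f : L2 d, ∀ᵐ E : ℝ ∂(volume.restrict (Set.Ioi 0)),
      ∃ h : MemLp (energyShell f E) 2 (volume : Measure (Space d)).toSphere,
        M E (h.toLp (energyShell f E)) =ᵐ[(volume : Measure (Space d)).toSphere]
          energyShell (S f) E

end

end MagneticScattering

/-! The difference `B = A' - A` is curl-free and `O(|x|^{-ρ})` with `ρ > 1`, so it is the gradient
of a function `φ` that tends to zero at infinity. Multiplication `G` by `e^{iφ}` carries `H` to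
`H'`, because `(i∇ + A + ∇φ)(e^{iφ} u) = e^{iφ} (i∇ + A) u`. Hence `e^{iH't} e^{-iH₀t} = G e^{iHt}
G⁻¹ e^{-iH₀t}`. The free evolution leaves every bounded region while `e^{-iφ} - 1` vanishes at
infinity, so `G⁻¹` can be dropped in the limit and `W±(H', H₀) = G W±(H, H₀)`. The same unitary `G`
occurs for both signs and cancels in `W₊* W₋`.

Potential: minus the integral of `B_i` over the ray from `x` in the direction `e_i` is a weak
potential of `B` (`isWeakGradient_neg_rayIntegral`), and it decays on `x_i ≥ -1`. The opposite ray
gives a potential that decays on `x_i ≤ 1`. The two differ by a constant, and since `d ≥ 2` the slab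
`|x_i| ≤ 1` is unbounded, so the constant is zero (`exists_isWeakGradient`).

Gauge covariance: `φ` is only locally integrable and `e^{iφ}` is no admissible multiplier of test
functions. The identity is proved for mollifications of `φ` and passed to the limit
(`HasMagneticGradient.gauge`).

Local decay: differentiating `e^{it|2πξ|²} w` in `ξ_i` produces a factor `t ξ_i`. In position space,
`|t|` times one free solution is therefore bounded by `|x|` times a second plus a third, all of
constant norm (`norm_smul_freeEvolution_le`, `tendsto_mul_freeEvolution`).

Finally, the scattering operator determines the scattering matrix for almost every energy, since
countably many functions restrict to a dense set on almost every energy shell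
(`ae_eq_of_energyShell`). -/

namespace MagneticScattering

/-! ### Unitary groups, their generators, and wave operators under conjugation. -/

section UnitaryGroups

variable {X : Type*} [NormedAddCommGroup X] [InnerProductSpace ℂ X] [CompleteSpace X]
  {H H' H₀ : X → X → Prop} {U V U₀ : ℝ → X →L[ℂ] X}

namespace IsUnitaryGroupOf

lemma norm_map (hU : IsUnitaryGroupOf H U) (t : ℝ) (x : X) : ‖U t x‖ = ‖x‖ :=
  ContinuousLinearMap.norm_map_of_mem_unitary (hU.mem_unitary t) x

lemma map_add_apply (hU : IsUnitaryGroupOf H U) (s t : ℝ) (x : X) :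
    U (s + t) x = U s (U t x) := by
  rw [hU.map_add]; rfl

lemma map_map_neg (hU : IsUnitaryGroupOf H U) (t : ℝ) (x : X) : U t (U (-t) x) = x := by
  rw [← hU.map_add_apply, add_neg_cancel, hU.map_zero]; rfl

lemma hasDerivAt (hU : IsUnitaryGroupOf H U) {u f : X} (h : H u f) (t : ℝ) :
    HasDerivAt (fun s => U s u) (U t (Complex.I • f)) t := by
  have h0 := (hU.generator u f).1 h
  have h1 : HasDerivAt (fun s => U (s - t) u) (Complex.I • f) t := by
    have := HasDerivAt.comp_sub_const (f := fun s => U s u) t t (by simpa using h0)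
    simpa using this
  have h2 := (((U t).restrictScalars ℝ).hasFDerivAt.comp_hasDerivAt t h1)
  refine h2.congr_of_eventuallyEq (Eventually.of_forall fun s => ?_)
  simp only [ContinuousLinearMap.coe_restrictScalars', Function.comp]
  rw [← hU.map_add_apply]; congr 2; ring

lemma map_mem (hU : IsUnitaryGroupOf H U) {u f : X} (h : H u f) (t : ℝ) :
    H (U t u) (U t f) := by
  rw [hU.generator]
  have h1 : HasDerivAt (fun s => U (s + t) u) (U t (Complex.I • f)) 0 :=
    HasDerivAt.comp_add_const (f := fun s => U s u) 0 t (by simpa using hU.hasDerivAt h t)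
  rw [map_smul] at h1
  simpa only [hU.map_add_apply] using h1

/-- Isometry disposes of the variation of `x s`, strong continuity of the variation of the group.
This replaces norm continuity of `U` in the product rule below. -/
lemma tendsto_map_neg (hU : IsUnitaryGroupOf H U) {x : ℝ → X} {y : X} {t : ℝ} {l : Filter ℝ}
    (hl : l ≤ 𝓝 t) (hx : Tendsto x l (𝓝 y)) :
    Tendsto (fun s => U (-s) (x s)) l (𝓝 (U (-t) y)) := by
  have h1 : Tendsto (fun s => U (-s) (x s - y)) l (𝓝 0) := by
    rw [tendsto_zero_iff_norm_tendsto_zero]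
    simp only [hU.norm_map]
    exact tendsto_iff_norm_sub_tendsto_zero.1 hx
  have h2 : Tendsto (fun s => U (-s) y) l (𝓝 (U (-t) y)) :=
    (((hU.continuous y).comp continuous_neg).tendsto t).mono_left hl
  simpa using h1.add h2

/-- A solution of the Schrödinger equation `v' = i H v` is `v t = U t (v 0)`. -/
lemma eq_of_hasDerivAt (hU : IsUnitaryGroupOf H U) {v f : ℝ → X} (hH : ∀ t, H (v t) (f t))
    (hv : ∀ t, HasDerivAt v (Complex.I • f t) t) (t : ℝ) : v t = U t (v 0) := by
  -- Product rule with the splitting `U (-s) (v s) = U (-s) (v s - v t) + U (-s) (v t)`: the two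
  -- terms have opposite derivatives at `s = t`.
  have key : ∀ t, HasDerivAt (fun s => U (-s) (v s)) 0 t := by
    intro t
    have h1 : HasDerivAt (fun s => U (-s) (v t)) (-(U (-t) (Complex.I • f t))) t := by
      have := (hU.hasDerivAt (hH t) (-t)).scomp t (hasDerivAt_neg t)
      simpa [Function.comp_def] using this
    have h2 : HasDerivAt (fun s => U (-s) (v s - v t)) (U (-t) (Complex.I • f t)) t := by
      rw [hasDerivAt_iff_tendsto_slope]
      have h3 := hU.tendsto_map_neg (t := t) nhdsWithin_le_nhds
        (hasDerivAt_iff_tendsto_slope.1 (hv t))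
      refine h3.congr fun s => ?_
      simp [slope_def_module]
    have := h2.add h1
    rw [add_neg_cancel] at this
    refine this.congr_of_eventuallyEq (Eventually.of_forall fun s => ?_)
    simp
  have hc : ∀ t, (fun s => U (-s) (v s)) t = (fun s => U (-s) (v s)) 0 :=
    fun t => is_const_of_deriv_eq_zero (fun s => (key s).differentiableAt)
      (fun s => (key s).deriv) t 0
  have := hc t
  simp only [neg_zero, hU.map_zero, one_apply_eq_self] at this
  rw [← this, hU.map_map_neg]

/-- The averages `h⁻¹ ∫₀ʰ U s u ds` converge to `u`, and they lie in the domain because translating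
the integral by `t` only moves its endpoints. -/
lemma dense_domain (hU : IsUnitaryGroupOf H U) : Dense {u : X | ∃ f, H u f} := by
  intro u
  have hint : ∀ a b, IntervalIntegrable (fun s => U s u) volume a b :=
    fun a b => (hU.continuous u).intervalIntegrable a b
  have hd : ∀ b, HasDerivAt (fun h => ∫ s in (0 : ℝ)..h, U s u) (U b u) b := fun b =>
    intervalIntegral.integral_hasDerivAt_right (hint 0 b)
      ((hU.continuous u).stronglyMeasurableAtFilter _ _) (hU.continuous u).continuousAt
  have hdom : ∀ h : ℝ, H (∫ s in (0 : ℝ)..h, U s u) (-Complex.I • (U h u - u)) := by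
    intro h
    rw [hU.generator]
    have hU' : ∀ t, U t (∫ s in (0 : ℝ)..h, U s u) =
        (∫ s in (0 : ℝ)..(h + t), U s u) - ∫ s in (0 : ℝ)..t, U s u := by
      intro t
      rw [← ContinuousLinearMap.intervalIntegral_comp_comm _ (hint _ _)]
      simp only [← hU.map_add_apply]
      rw [intervalIntegral.integral_comp_add_left (fun s => U s u) t, add_zero,
        intervalIntegral.integral_interval_sub_left (hint _ _) (hint _ _), add_comm]
    simp only [hU']
    have h1 : HasDerivAt (fun t => ∫ s in (0 : ℝ)..(h + t), U s u) (U h u) 0 :=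
      HasDerivAt.comp_const_add (f := fun h => ∫ s in (0 : ℝ)..h, U s u) h 0 (by simpa using hd h)
    have h2 := h1.sub (hd 0)
    simp only [hU.map_zero, one_apply_eq_self] at h2
    convert h2 using 1
    · rfl
    · rw [smul_smul]; simp
  have hlim : Tendsto (fun h : ℝ => ((h⁻¹ : ℝ) : ℂ) • ∫ s in (0 : ℝ)..h, U s u) (𝓝[≠] 0) (𝓝 u) := by
    have := hasDerivAt_iff_tendsto_slope.1 (hd 0)
    simp only [hU.map_zero, one_apply_eq_self] at this
    refine this.congr fun s => ?_
    rw [slope_def_module, intervalIntegral.integral_same, sub_zero, sub_zero, Complex.coe_smul]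
  refine mem_closure_of_tendsto hlim (Eventually.of_forall fun h => ?_)
  refine ⟨((h⁻¹ : ℝ) : ℂ) • (-Complex.I • (U h u - u)), ?_⟩
  have h1 := (hU.generator _ _).1 (hdom h)
  rw [hU.generator]
  have h2 := h1.const_smul ((h⁻¹ : ℝ) : ℂ)
  rw [smul_comm] at h2
  refine h2.congr_of_eventuallyEq (Eventually.of_forall fun s => ?_)
  simp

/-- A unitary group is determined by its generator. -/
lemma eq (hU : IsUnitaryGroupOf H U) (hV : IsUnitaryGroupOf H V) : U = V := by
  funext t
  refine ContinuousLinearMap.ext fun x => ?_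
  refine hU.dense_domain.induction (P := fun x => U t x = V t x) ?_
    (isClosed_eq (U t).continuous (V t).continuous) x
  rintro u ⟨f, hf⟩
  have := hV.eq_of_hasDerivAt (v := fun t => U t u) (f := fun t => U t f)
    (fun t => hU.map_mem hf t) (fun t => by simpa using hU.hasDerivAt hf t) t
  simpa [hU.map_zero] using this

/-- Unitary equivalent operators generate unitarily equivalent groups. -/
lemma conj (hU : IsUnitaryGroupOf H U) (G : X ≃ₗᵢ[ℂ] X)
    (hG : ∀ u f, H u f ↔ H' (G u) (G f)) :
    IsUnitaryGroupOf H' fun t => (G : X →L[ℂ] X) * U t * (G.symm : X →L[ℂ] X) := by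
  have hinv : (G : X →L[ℂ] X) * (G.symm : X →L[ℂ] X) = 1 := by ext; simp
  have hinv' : (G.symm : X →L[ℂ] X) * (G : X →L[ℂ] X) = 1 := by ext; simp
  have hstar : star (G : X →L[ℂ] X) = (G.symm : X →L[ℂ] X) :=
    LinearIsometryEquiv.adjoint_eq_symm G
  have hG1 : (G : X →L[ℂ] X) ∈ unitary (X →L[ℂ] X) := by
    rw [Unitary.mem_iff, hstar]; exact ⟨hinv', hinv⟩
  have hG2 : (G.symm : X →L[ℂ] X) ∈ unitary (X →L[ℂ] X) := by
    rw [← hstar]; exact Unitary.star_mem hG1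
  refine ⟨fun t => mul_mem (mul_mem hG1 (hU.mem_unitary t)) hG2, ?_, ?_, ?_, ?_⟩
  · rw [hU.map_zero, mul_one, hinv]
  · intro s t
    rw [hU.map_add]
    calc _ = (G : X →L[ℂ] X) * U s * 1 * U t * (G.symm : X →L[ℂ] X) := by
            simp only [mul_one, mul_assoc]
      _ = _ := by rw [← hinv']; simp only [mul_assoc]
  · intro u
    exact G.continuous.comp (hU.continuous (G.symm u))
  · intro u f
    have h1 : H' u f ↔ H (G.symm u) (G.symm f) := by simp [hG]
    rw [h1, hU.generator]
    constructor
    · intro h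
      have := ((G : X →L[ℂ] X).restrictScalars ℝ).hasFDerivAt.comp_hasDerivAt 0 h
      simpa [Function.comp_def] using this
    · intro h
      have := ((G.symm : X →L[ℂ] X).restrictScalars ℝ).hasFDerivAt.comp_hasDerivAt 0 h
      simpa [Function.comp_def] using this

end IsUnitaryGroupOf

/-- The groups are existentially quantified in the definition, so uniqueness of limits applies only
after the generators have been seen to determine them. -/
lemma IsWaveOperator.eq {l : Filter ℝ} [l.NeBot] {W W' : X →L[ℂ] X}
    (hW : IsWaveOperator l H H₀ W) (hW' : IsWaveOperator l H H₀ W') : W = W' := by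
  obtain ⟨U, U₀, hU, hU₀, h⟩ := hW
  obtain ⟨V, V₀, hV, hV₀, h'⟩ := hW'
  obtain rfl := hU.eq hV
  obtain rfl := hU₀.eq hV₀
  exact ContinuousLinearMap.ext fun f => tendsto_nhds_unique (h f) (h' f)

/-- If `G` intertwines `H` and `H'` and `G⁻¹ - 1` vanishes asymptotically along the free evolution,
then `W(H', H₀) = G W(H, H₀)`. -/
lemma IsWaveOperator.conj {l : Filter ℝ} {W : X →L[ℂ] X} (hW : IsWaveOperator l H H₀ W)
    (G : X ≃ₗᵢ[ℂ] X) (hG : ∀ u f, H u f ↔ H' (G u) (G f))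
    (hdecay : ∀ U₀, IsUnitaryGroupOf H₀ U₀ → ∀ f,
      Tendsto (fun t => G.symm (U₀ (-t) f) - U₀ (-t) f) l (𝓝 0)) :
    IsWaveOperator l H' H₀ ((G : X →L[ℂ] X) * W) := by
  obtain ⟨U, U₀, hU, hU₀, h⟩ := hW
  refine ⟨_, U₀, hU.conj G hG, hU₀, fun f => ?_⟩
  have h1 : Tendsto (fun t => U t (G.symm (U₀ (-t) f) - U₀ (-t) f)) l (𝓝 0) := by
    rw [tendsto_zero_iff_norm_tendsto_zero]
    simp only [hU.norm_map]
    exact tendsto_zero_iff_norm_tendsto_zero.1 (hdecay U₀ hU₀ f)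
  have h2 := (G.continuous.tendsto _).comp (h1.add (h f))
  simpa [Function.comp_def] using h2

/-- Unitarity of `G` makes it cancel; this is why the scattering operator does not see the gauge. -/
lemma adjoint_comp_conj (G : X ≃ₗᵢ[ℂ] X) (W W' : X →L[ℂ] X) :
    ContinuousLinearMap.adjoint ((G : X →L[ℂ] X) * W) * ((G : X →L[ℂ] X) * W') =
      ContinuousLinearMap.adjoint W * W' := by
  refine ContinuousLinearMap.ext fun x => ext_inner_left ℂ fun y => ?_
  simp [ContinuousLinearMap.adjoint_inner_right]

end UnitaryGroups

/-! ### The free evolution in the Fourier representation. -/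

noncomputable section FreeEvolution

open Laplacian LineDeriv
open scoped SchwartzMap

variable {d : ℕ}

lemma IsTest.ofReal_comp {φ : Space d → ℝ} (hφ : IsTest φ) :
    ContDiff ℝ ∞ (fun x => (φ x : ℂ)) ∧ HasCompactSupport fun x => (φ x : ℂ) :=
  ⟨Complex.ofRealCLM.contDiff.comp hφ.1, hφ.2.comp_left Complex.ofReal_zero⟩

/-- The symbol `|2πξ|²` of `-Δ`. -/
def freeSymbol (ξ : Space d) : ℝ := (2 * Real.pi) ^ 2 * ‖ξ‖ ^ 2

lemma contDiff_freeSymbol : ContDiff ℝ ∞ (freeSymbol (d := d)) :=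
  contDiff_const.mul (contDiff_norm_sq ℝ)

lemma freeSymbol_nonneg (ξ : Space d) : 0 ≤ freeSymbol ξ := by
  unfold freeSymbol; positivity

lemma freeHamiltonian_toLp (s : 𝓢(Space d, ℂ)) :
    freeHamiltonian d (s.toLp 2 volume) ((-Δ s).toLp 2 volume) := by
  intro φ hφ
  obtain ⟨h1, h2⟩ := hφ.ofReal_comp
  have h3 : (2 : WithTop ℕ∞) ≤ ∞ := WithTop.coe_le_coe.2 (le_top : (2 : ℕ∞) ≤ ⊤)
  have hlap : ∀ x, (Δ (h2.toSchwartzMap h1)) x = ((Δ φ x : ℝ) : ℂ) := by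
    intro x
    rw [SchwartzMap.laplacian_apply]
    exact (hφ.1.contDiffAt.of_le h3).laplacian_CLM_comp_left
      (l := Complex.ofRealCLM)
  have hibp := SchwartzMap.integral_mul_laplacian_right_eq_left (μ := volume) s
    (h2.toSchwartzMap h1)
  have hL := SchwartzMap.coeFn_toLp (-Δ s) 2 (volume : Measure (Space d))
  have hR := SchwartzMap.coeFn_toLp s 2 (volume : Measure (Space d))
  calc ∫ x, ((-Δ s).toLp 2 volume) x * (φ x : ℂ)
      = ∫ x, -(Δ s x * (h2.toSchwartzMap h1) x) := by
        refine integral_congr_ae ?_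
        filter_upwards [hL] with x hx
        rw [hx, neg_apply, neg_mul]
        rfl
    _ = -∫ x, s x * (Δ (h2.toSchwartzMap h1)) x := by rw [integral_neg, hibp]
    _ = _ := by
        congr 1
        refine integral_congr_ae ?_
        filter_upwards [hR] with x hx
        rw [hx, hlap]

lemma neg_laplacian_fourierInv {s q : 𝓢(Space d, ℂ)} (h : ∀ ξ, q ξ = freeSymbol ξ * s ξ) :
    -Δ (𝓕⁻ s) = 𝓕⁻ q := by
  have hg : Function.HasTemperateGrowth (fun ξ : Space d => ‖ξ‖ ^ 2) := by fun_prop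
  rw [SchwartzMap.laplacian_eq_fourierMultiplierCLM, SchwartzMap.fourierMultiplierCLM_apply,
    FourierTransform.fourier_fourierInv_eq, neg_smul, neg_neg]
  have : q = ((2 * Real.pi) ^ 2 : ℝ) • SchwartzMap.smulLeftCLM ℂ (fun ξ : Space d => ‖ξ‖ ^ 2) s := by
    ext ξ
    rw [h, smul_apply, SchwartzMap.smulLeftCLM_apply_apply hg]
    simp [freeSymbol]; ring
  rw [this, ← Complex.coe_smul, ← Complex.coe_smul, FourierTransform.fourierInv_smul]

/-- The product of a smooth function with a smooth compactly supported function, as a Schwartz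
function. -/
def smoothMul (c : Space d → ℂ) (hc : ContDiff ℝ ∞ c) (w : 𝓢(Space d, ℂ))
    (hw : HasCompactSupport w) : 𝓢(Space d, ℂ) :=
  (HasCompactSupport.mul_left (f := c) hw).toSchwartzMap (hc.mul (w.smooth ⊤))

@[simp] lemma smoothMul_apply (c : Space d → ℂ) (hc : ContDiff ℝ ∞ c) (w : 𝓢(Space d, ℂ))
    (hw : HasCompactSupport w) (x : Space d) : smoothMul c hc w hw x = c x * w x := rfl

lemma hasCompactSupport_smoothMul (c : Space d → ℂ) (hc : ContDiff ℝ ∞ c) (w : 𝓢(Space d, ℂ))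
    (hw : HasCompactSupport w) : HasCompactSupport (smoothMul c hc w hw) :=
  HasCompactSupport.mul_left (f := c) hw

/-- The multiplier `e^{it|2πξ|²}`. -/
def freePhase (t : ℝ) (ξ : Space d) : ℂ := Complex.exp (Complex.I * (t * freeSymbol ξ : ℝ))

lemma contDiff_freePhase (t : ℝ) : ContDiff ℝ ∞ (freePhase t : Space d → ℂ) :=
  (contDiff_const.mul (Complex.ofRealCLM.contDiff.comp
    (contDiff_const.mul contDiff_freeSymbol))).cexp

lemma norm_freePhase (t : ℝ) (ξ : Space d) : ‖freePhase t ξ‖ = 1 := by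
  rw [freePhase, mul_comm]; exact Complex.norm_exp_ofReal_mul_I _

lemma contDiff_ofReal_freeSymbol : ContDiff ℝ ∞ (fun ξ : Space d => (freeSymbol ξ : ℂ)) :=
  Complex.ofRealCLM.contDiff.comp contDiff_freeSymbol

/-- The solution `e^{it|2πξ|²} w` of the free equation in the Fourier representation. -/
def freeEvolution (t : ℝ) (w : 𝓢(Space d, ℂ)) (hw : HasCompactSupport w) : 𝓢(Space d, ℂ) :=
  smoothMul (freePhase t) (contDiff_freePhase t) w hw

/-- `|2πξ|² w`. -/
def symbolMul (w : 𝓢(Space d, ℂ)) (hw : HasCompactSupport w) : 𝓢(Space d, ℂ) :=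
  smoothMul _ contDiff_ofReal_freeSymbol w hw

lemma hasCompactSupport_symbolMul (w : 𝓢(Space d, ℂ)) (hw : HasCompactSupport w) :
    HasCompactSupport (symbolMul w hw) := hasCompactSupport_smoothMul _ _ w hw

/-- Taylor's bound covers `|x| ≤ 1`; for `|x| ≥ 1` the triangle inequality gives `2|x| ≤ 2x²`. -/
lemma norm_exp_sub_one_sub_le (x : ℝ) :
    ‖Complex.exp (Complex.I * x) - 1 - Complex.I * x‖ ≤ 2 * x ^ 2 := by
  rcases le_total |x| 1 with h | h
  · have h1 := Complex.norm_exp_sub_one_sub_id_le (x := Complex.I * x) (by simpa using h)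
    refine h1.trans ?_
    have h2 : ‖Complex.I * (x : ℂ)‖ = |x| := by simp
    rw [h2, sq_abs]
    nlinarith [sq_nonneg x]
  · have h1 := Real.norm_exp_I_mul_ofReal_sub_one_le (x := x)
    refine (norm_sub_le _ _).trans ?_
    have h2 : ‖Complex.I * (x : ℂ)‖ = |x| := by simp
    rw [h2]
    rw [Real.norm_eq_abs] at h1
    nlinarith [sq_abs x]

/-- The Taylor remainder at `ξ` is at most `2 h² p² |w|` with `p = |2πξ|²`, and `p² w` is in `L²`
because `w` has compact support; hence the `L²` remainder is `O(h²)`. -/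
lemma hasDerivAt_freeEvolution (w : 𝓢(Space d, ℂ)) (hw : HasCompactSupport w) (t : ℝ) :
    HasDerivAt (fun t => (freeEvolution t w hw).toLp 2 (volume : Measure (Space d)))
      (Complex.I • (freeEvolution t (symbolMul w hw)
        (hasCompactSupport_symbolMul w hw)).toLp 2 volume) t := by
  set q := symbolMul w hw
  have hq : HasCompactSupport q := hasCompactSupport_symbolMul w hw
  rw [hasDerivAt_iff_isLittleO_nhds_zero]
  refine Asymptotics.IsBigO.trans_isLittleO (g := fun h : ℝ => h ^ 2) ?_
    (Asymptotics.isLittleO_pow_id one_lt_two)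
  refine Asymptotics.IsBigO.of_bound (2 * ‖(symbolMul q hq).toLp 2 (volume : Measure (Space d))‖)
    (Eventually.of_forall fun h => ?_)
  have hrw : (freeEvolution (t + h) w hw).toLp 2 (volume : Measure (Space d)) -
      (freeEvolution t w hw).toLp 2 volume - h • Complex.I • (freeEvolution t q hq).toLp 2 volume =
      (freeEvolution (t + h) w hw - freeEvolution t w hw -
        h • Complex.I • freeEvolution t q hq).toLp 2 volume := rfl
  rw [hrw]
  calc _ ≤ (2 * ‖h ^ 2‖) * ‖(symbolMul q hq).toLp 2 (volume : Measure (Space d))‖ := by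
        refine Lp.norm_le_mul_norm_of_ae_le_mul ?_
        filter_upwards [SchwartzMap.coeFn_toLp (freeEvolution (t + h) w hw - freeEvolution t w hw -
          h • Complex.I • freeEvolution t q hq) 2 volume,
          SchwartzMap.coeFn_toLp (symbolMul q hq) 2 volume] with ξ h1 h2
        rw [h1, h2]
        have e1 : (freeEvolution (t + h) w hw - freeEvolution t w hw -
            h • Complex.I • freeEvolution t q hq) ξ = freePhase t ξ *
            (Complex.exp (Complex.I * (h * freeSymbol ξ : ℝ)) - 1 -
              Complex.I * (h * freeSymbol ξ : ℝ)) * w ξ := by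
          have e2 : freePhase (t + h) ξ =
              freePhase t ξ * Complex.exp (Complex.I * (h * freeSymbol ξ : ℝ)) := by
            rw [freePhase, freePhase, ← Complex.exp_add]; push_cast; ring_nf
          simp [freeEvolution, e2, q, symbolMul]; ring
        rw [e1, norm_mul, norm_mul, norm_freePhase, one_mul]
        have e3 : ‖(symbolMul q hq) ξ‖ = freeSymbol ξ ^ 2 * ‖w ξ‖ := by
          simp [symbolMul, q, abs_of_nonneg (freeSymbol_nonneg ξ)]; ring
        rw [e3]
        refine (mul_le_mul_of_nonneg_right (norm_exp_sub_one_sub_le _) (norm_nonneg _)).trans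
          (le_of_eq ?_)
        rw [Real.norm_eq_abs, abs_of_nonneg (sq_nonneg h)]; ring
    _ = _ := by ring

/-- The group `U₀` is known only through its generator. The explicit formula solves the Schrödinger
equation inside the domain, so uniqueness of solutions identifies it with `U₀`. -/
lemma IsUnitaryGroupOf.apply_fourierInv {U₀ : ℝ → L2 d →L[ℂ] L2 d}
    (hU : IsUnitaryGroupOf (freeHamiltonian d) U₀) (w : 𝓢(Space d, ℂ)) (hw : HasCompactSupport w)
    (t : ℝ) : U₀ t ((𝓕⁻ w).toLp 2) = (𝓕⁻ (freeEvolution t w hw)).toLp 2 := by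
  have h0 : freeEvolution 0 w hw = w := by ext; simp [freeEvolution, freePhase]
  have key := hU.eq_of_hasDerivAt (v := fun t => (𝓕⁻ (freeEvolution t w hw)).toLp 2)
    (f := fun t => (𝓕⁻ (freeEvolution t (symbolMul w hw)
        (hasCompactSupport_symbolMul w hw))).toLp 2) ?_ ?_ t
  · simp only [h0] at key
    exact key.symm
  · intro t
    have h1 := freeHamiltonian_toLp (𝓕⁻ (freeEvolution t w hw))
    rwa [neg_laplacian_fourierInv (q := freeEvolution t (symbolMul w hw)
        (hasCompactSupport_symbolMul w hw))] at h1
    intro ξ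
    simp [freeEvolution, symbolMul]; ring
  · intro t
    simp only [← SchwartzMap.toLp_fourierInv_eq]
    have h1 := hasDerivAt_freeEvolution w hw t
    have h2 := ((((Lp.fourierTransformₗᵢ (Space d) ℂ).symm :
      L2 d ≃ₗᵢ[ℂ] L2 d) : L2 d →L[ℂ] L2 d).restrictScalars ℝ).hasFDerivAt.comp_hasDerivAt t h1
    simp only [ContinuousLinearMap.coe_restrictScalars', map_smul] at h2
    exact h2

end FreeEvolution

/-! ### Local decay of the free evolution. -/

noncomputable section LocalDecay

open LineDeriv
open scoped SchwartzMap

variable {d : ℕ}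

lemma contDiff_ofReal_coord (i : Fin d) : ContDiff ℝ ∞ (fun x : Space d => (x i : ℂ)) :=
  Complex.ofRealCLM.contDiff.comp (EuclideanSpace.proj (𝕜 := ℝ) i).contDiff

lemma hasDerivAt_freePhase_line (t : ℝ) (ξ : Space d) (i : Fin d) :
    HasLineDerivAt ℝ (freePhase t) (2 * (2 * Real.pi) ^ 2 * Complex.I * t * ξ i * freePhase t ξ) ξ
      (EuclideanSpace.single i 1) := by
  have h1 : ∀ s : ℝ, freeSymbol (ξ + s • EuclideanSpace.single i (1 : ℝ)) =
      (2 * Real.pi) ^ 2 * (‖ξ‖ ^ 2 + 2 * s * ξ i + s ^ 2) := by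
    intro s
    rw [freeSymbol, norm_add_sq_real, inner_smul_right, norm_smul]
    simp [EuclideanSpace.inner_single_right]
    ring
  have h2 : HasDerivAt (fun s : ℝ => (2 * Real.pi) ^ 2 * (‖ξ‖ ^ 2 + 2 * s * ξ i + s ^ 2))
      ((2 * Real.pi) ^ 2 * (2 * ξ i)) 0 := by
    have h3 : HasDerivAt (fun s : ℝ => ‖ξ‖ ^ 2 + 2 * s * ξ i + s ^ 2) (2 * ξ i) 0 := by
      have ha : HasDerivAt (fun s : ℝ => 2 * s * ξ i) (2 * ξ i) 0 := by
        simpa using ((hasDerivAt_id (0 : ℝ)).const_mul 2).mul_const (ξ i)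
      have hb : HasDerivAt (fun s : ℝ => s ^ 2) 0 0 := by
        simpa using hasDerivAt_pow 2 (0 : ℝ)
      have hc := (ha.const_add (‖ξ‖ ^ 2)).add hb
      rw [add_zero] at hc
      exact hc
    exact h3.const_mul _
  have h4 := ((h2.const_mul t).ofReal_comp.const_mul Complex.I).cexp
  unfold HasLineDerivAt
  simp only [freePhase, h1]
  refine h4.congr_deriv ?_
  simp [freeSymbol]; ring

/-- `ξᵢ w`. -/
def coordMul (i : Fin d) (w : 𝓢(Space d, ℂ)) (hw : HasCompactSupport w) : 𝓢(Space d, ℂ) :=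
  smoothMul (fun x : Space d => (x i : ℂ)) (contDiff_ofReal_coord i) w hw

lemma hasCompactSupport_coordMul (i : Fin d) (w : 𝓢(Space d, ℂ)) (hw : HasCompactSupport w) :
    HasCompactSupport (coordMul i w hw) :=
  hasCompactSupport_smoothMul (fun x : Space d => (x i : ℂ)) (contDiff_ofReal_coord i) w hw

lemma hasCompactSupport_lineDerivOp (m : Space d) (w : 𝓢(Space d, ℂ)) (hw : HasCompactSupport w) :
    HasCompactSupport (∂_{m} w : 𝓢(Space d, ℂ)) :=
  IsCompact.of_isClosed_subset hw (isClosed_tsupport _) (SchwartzMap.tsupport_lineDerivOp_subset m w)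

/-- `∂ᵢ (e^{itp} w) = 8π² i t e^{itp} ξᵢ w + e^{itp} ∂ᵢ w` for `p = |2πξ|²`. -/
lemma lineDerivOp_freeEvolution (t : ℝ) (w : 𝓢(Space d, ℂ)) (hw : HasCompactSupport w)
    (i : Fin d) :
    ∂_{EuclideanSpace.single i (1 : ℝ)} (freeEvolution t w hw) =
      (2 * (2 * Real.pi) ^ 2 * Complex.I * t : ℂ) •
        freeEvolution t (coordMul i w hw) (hasCompactSupport_coordMul i w hw) +
      freeEvolution t (∂_{EuclideanSpace.single i (1 : ℝ)} w)
        (hasCompactSupport_lineDerivOp _ w hw) := by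
  ext ξ
  have h1 := hasDerivAt_freePhase_line t ξ i
  have h2 : HasLineDerivAt ℝ w ((∂_{EuclideanSpace.single i (1 : ℝ)} w : 𝓢(Space d, ℂ)) ξ) ξ
      (EuclideanSpace.single i (1 : ℝ)) := by
    rw [SchwartzMap.lineDerivOp_apply_eq_fderiv]
    exact (w.hasFDerivAt ξ).hasLineDerivAt _
  rw [SchwartzMap.lineDerivOp_apply]
  have h3 := HasDerivAt.mul h1 h2
  simp only [zero_smul, add_zero] at h3
  have h4 : HasLineDerivAt ℝ (freeEvolution t w hw) _ ξ (EuclideanSpace.single i (1 : ℝ)) := h3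
  rw [h4.lineDeriv]
  rw [add_apply, smul_apply]
  simp only [freeEvolution, coordMul, smoothMul_apply, smul_eq_mul]
  ring

/-- The inverse Fourier transform turns `∂ᵢ` into multiplication by `-2πi xᵢ`. Applied to
`lineDerivOp_freeEvolution`, it trades the growing factor `t` for the weight `|x|`, which is bounded
on balls. -/
lemma norm_smul_freeEvolution_le (t : ℝ) (w : 𝓢(Space d, ℂ)) (hw : HasCompactSupport w)
    (i : Fin d) (x : Space d) :
    2 * (2 * Real.pi) ^ 2 * |t| *
        ‖(𝓕⁻ (freeEvolution t (coordMul i w hw) (hasCompactSupport_coordMul i w hw))) x‖ ≤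
      2 * Real.pi * ‖x‖ * ‖(𝓕⁻ (freeEvolution t w hw)) x‖ +
        ‖(𝓕⁻ (freeEvolution t (∂_{EuclideanSpace.single i (1 : ℝ)} w)
          (hasCompactSupport_lineDerivOp _ w hw))) x‖ := by
  have h1 := congrArg (fun s : 𝓢(Space d, ℂ) => (𝓕⁻ s) x) (lineDerivOp_freeEvolution t w hw i)
  simp only [FourierTransform.fourierInv_add, FourierTransform.fourierInv_smul] at h1
  rw [SchwartzMap.fourierInv_lineDerivOp_eq, add_apply, smul_apply, smul_apply,
    SchwartzMap.smulLeftCLM_apply_apply (by fun_prop)] at h1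
  have h2 := congrArg norm (eq_sub_of_add_eq h1.symm)
  have h3 := h2.le.trans (norm_sub_le _ _)
  have h4 : ‖(2 * (2 * Real.pi) ^ 2 * Complex.I * t : ℂ)‖ = 2 * (2 * Real.pi) ^ 2 * |t| := by
    simp [abs_of_pos Real.pi_pos]
  rw [norm_smul, h4] at h3
  refine h3.trans (add_le_add_left ?_ _)
  rw [norm_smul, norm_smul, norm_neg, ← mul_assoc]
  refine mul_le_mul_of_nonneg_right ?_ (norm_nonneg _)
  have h5 : ‖(2 * Real.pi * Complex.I : ℂ)‖ = 2 * Real.pi := by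
    simp [Real.pi_pos.le]
  rw [h5]
  refine mul_le_mul_of_nonneg_left ?_ (by positivity)
  simpa using norm_inner_le_norm (𝕜 := ℝ) x (EuclideanSpace.single i (1 : ℝ))

lemma norm_fourierInv_freeEvolution_toLp (t : ℝ) (w : 𝓢(Space d, ℂ)) (hw : HasCompactSupport w) :
    ‖(𝓕⁻ (freeEvolution t w hw)).toLp 2 (volume : Measure (Space d))‖ =
      ‖w.toLp 2 (volume : Measure (Space d))‖ := by
  rw [← SchwartzMap.toLp_fourierInv_eq]
  refine ((Lp.fourierTransformₗᵢ (Space d) ℂ).symm.norm_map _).trans ?_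
  rw [SchwartzMap.norm_toLp, SchwartzMap.norm_toLp]
  congr 1
  refine eLpNorm_congr_norm_ae (Eventually.of_forall fun ξ => ?_)
  simp [freeEvolution, norm_freePhase]

/-- The functions with Fourier transform `ξᵢ w`, `w` smooth with compact support, are total. -/
lemma eq_zero_of_inner_fourierInv_coordMul (i : Fin d) (g : L2 d)
    (h : ∀ (w : 𝓢(Space d, ℂ)) (hw : HasCompactSupport w),
      ⟪(𝓕⁻ (coordMul i w hw)).toLp 2 (volume : Measure (Space d)), g⟫_ℂ = 0) : g = 0 := by
  have hloc : LocallyIntegrable (𝓕 g : L2 d) (volume : Measure (Space d)) :=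
    (Lp.memLp (𝓕 g)).locallyIntegrable one_le_two
  -- By Plancherel the hypothesis says that `ξᵢ ĝ` annihilates all test functions; it then remains
  -- to divide by `ξᵢ`, whose zero set is a null hyperplane.
  have h1 : ∀ᵐ ξ : Space d, ((ξ i : ℂ)) * (𝓕 g : L2 d) ξ = 0 := by
    refine ae_eq_zero_of_integral_contDiff_smul_eq_zero ?_ fun φ hφ hφ' => ?_
    · simpa [Pi.mul_def] using hloc.continuous_mul (contDiff_ofReal_coord i).continuous
    · obtain ⟨h1, h2⟩ := IsTest.ofReal_comp ⟨hφ, hφ'⟩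
      have h3 := h (h2.toSchwartzMap h1) h2
      rw [← SchwartzMap.toLp_fourierInv_eq, ← Lp.inner_fourier_eq,
        FourierTransform.fourier_fourierInv_eq, L2.inner_def] at h3
      rw [← h3]
      refine integral_congr_ae ?_
      filter_upwards [SchwartzMap.coeFn_toLp (coordMul i (h2.toSchwartzMap h1) h2) 2
        (volume : Measure (Space d))] with ξ hξ
      rw [hξ]
      change φ ξ • (((ξ i : ℝ) : ℂ) * (𝓕 g : L2 d) ξ) =
        (𝓕 g : L2 d) ξ * starRingEnd ℂ (((ξ i : ℝ) : ℂ) * (φ ξ : ℂ))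
      simp only [map_mul, Complex.conj_ofReal, Complex.real_smul]; ring
  have h2 : ∀ᵐ ξ : Space d, ξ i ≠ 0 := by
    have hne : LinearMap.ker (EuclideanSpace.proj (𝕜 := ℝ) i : Space d →L[ℝ] ℝ).toLinearMap ≠ ⊤ := by
      intro h
      have : EuclideanSpace.single i (1 : ℝ) ∈
          LinearMap.ker (EuclideanSpace.proj (𝕜 := ℝ) i : Space d →L[ℝ] ℝ).toLinearMap := by
        rw [h]; trivial
      simp at this
    have := Measure.addHaar_submodule (volume : Measure (Space d)) _ hne
    rw [ae_iff]
    refine measure_mono_null (fun ξ hξ => ?_) this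
    simpa using hξ
  have h3 : (𝓕 g : L2 d) = 0 := by
    rw [Lp.eq_zero_iff_ae_eq_zero]
    filter_upwards [h1, h2] with ξ hξ hξ'
    simpa [hξ'] using hξ
  have h4 := Lp.norm_fourier_eq g
  rw [h3, norm_zero] at h4
  exact norm_eq_zero.1 h4.symm

/-- Multiplication by a bounded function which vanishes at infinity annihilates the free evolution
asymptotically. -/
theorem tendsto_mul_freeEvolution (i : Fin d) {U₀ : ℝ → L2 d →L[ℂ] L2 d}
    (hU : IsUnitaryGroupOf (freeHamiltonian d) U₀) (T : L2 d →L[ℂ] L2 d) {θ : Space d → ℂ}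
    (hT : ∀ u : L2 d, T u =ᵐ[volume] fun x => θ x * u x) (hθ : ∀ x, ‖θ x‖ ≤ 2)
    (hθ' : ∀ ε > 0, ∃ R, ∀ᵐ x, R ≤ ‖x‖ → ‖θ x‖ ≤ ε) {l : Filter ℝ}
    (hl : Tendsto (fun t => |t|) l atTop) (f : L2 d) :
    Tendsto (fun t => T (U₀ t f)) l (𝓝 0) := by
  -- The good vectors form a closed subspace, since the operators `T (U₀ t)` are uniformly bounded.
  -- It suffices that `K` contains a total family.
  let K : Submodule ℂ (L2 d) :=
    { carrier := {f | Tendsto (fun t => T (U₀ t f)) l (𝓝 0)}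
      add_mem' := fun {a b} ha hb => by simpa using Tendsto.add ha hb
      zero_mem' := by simpa using tendsto_const_nhds
      smul_mem' := fun c a ha => by simpa using Tendsto.const_smul ha c }
  have hK : IsClosed (K : Set (L2 d)) := by
    rw [← isSeqClosed_iff_isClosed]
    intro a b ha hab
    change Tendsto (fun t => T (U₀ t b)) l (𝓝 0)
    rw [Metric.tendsto_nhds]
    intro ε hε
    have h1 : Tendsto (fun n => ‖T‖ * ‖b - a n‖) atTop (𝓝 0) := by
      have : Tendsto (fun n => ‖b - a n‖) atTop (𝓝 0) := by
        simpa using ((tendsto_const_nhds (x := b)).sub hab).norm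
      simpa using this.const_mul ‖T‖
    obtain ⟨n, hn⟩ := (h1.eventually_lt_const (half_pos hε)).exists
    filter_upwards [(Metric.tendsto_nhds.1 (ha n)) (ε / 2) (half_pos hε)] with t ht
    rw [dist_zero_right] at ht ⊢
    calc ‖T (U₀ t b)‖ = ‖T (U₀ t (b - a n)) + T (U₀ t (a n))‖ := by simp
      _ ≤ ‖T‖ * ‖b - a n‖ + ‖T (U₀ t (a n))‖ := by
        refine (norm_add_le _ _).trans (add_le_add_left ?_ _)
        exact (T.le_opNorm _).trans (by rw [hU.norm_map])
      _ < ε := by linarith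
  have hmem : ∀ (w : 𝓢(Space d, ℂ)) (hw : HasCompactSupport w),
      (𝓕⁻ (coordMul i w hw)).toLp 2 (volume : Measure (Space d)) ∈ K := by
    intro w hw
    change Tendsto _ l (𝓝 0)
    set e := EuclideanSpace.single i (1 : ℝ)
    set a : ℝ → L2 d := fun t => (𝓕⁻ (freeEvolution t w hw)).toLp 2 volume with ha
    set b : ℝ → L2 d := fun t => (𝓕⁻ (freeEvolution t (∂_{e} w)
          (hasCompactSupport_lineDerivOp _ w hw))).toLp 2 volume with hb
    set v : ℝ → L2 d := fun t => (𝓕⁻ (freeEvolution t (coordMul i w hw)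
          (hasCompactSupport_coordMul i w hw))).toLp 2 volume with hv
    have hUv : ∀ t, U₀ t ((𝓕⁻ (coordMul i w hw)).toLp 2 volume) = v t := fun t =>
      hU.apply_fourierInv _ (hasCompactSupport_coordMul i w hw) t
    simp only [hUv]
    rw [Metric.tendsto_nhds]
    intro ε hε
    set Nv := ‖(coordMul i w hw).toLp 2 (volume : Measure (Space d))‖
    set Na := ‖w.toLp 2 (volume : Measure (Space d))‖
    set Nb := ‖(∂_{e} w : 𝓢(Space d, ℂ)).toLp 2 (volume : Measure (Space d))‖
    have hNv : ∀ t, ‖v t‖ = Nv := fun t => norm_fourierInv_freeEvolution_toLp t _ _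
    have hNa : ∀ t, ‖a t‖ = Na := fun t => norm_fourierInv_freeEvolution_toLp t _ _
    have hNb : ∀ t, ‖b t‖ = Nb := fun t => norm_fourierInv_freeEvolution_toLp t _ _
    -- With this `δ` the region `|x| ≥ R` contributes at most `ε / 2`; the region `|x| < R` will
    -- contribute `O(1/|t|)`.
    set δ := ε / 2 / (Nv + 1) with hδ
    have hδ0 : 0 < δ := by positivity
    obtain ⟨R, hR⟩ := hθ' δ hδ0
    have hlim : Tendsto (fun t => (2 * Real.pi * |R| * Na + Nb) / |t|) l (𝓝 0) :=
      Tendsto.div_atTop tendsto_const_nhds hl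
    filter_upwards [hlim.eventually_lt_const (half_pos hε), hl.eventually_gt_atTop 0] with t ht ht0
    rw [dist_zero_right]
    set α : ℝ := 2 * Real.pi * |R| / |t|
    set β : ℝ := 1 / |t|
    have hα : 0 ≤ α := by positivity
    have hβ : 0 ≤ β := by positivity
    have hbound : ∀ᵐ x, ‖T (v t) x‖ ≤ ‖(δ * ‖v t x‖ + α * ‖a t x‖ + β * ‖b t x‖ : ℝ)‖ := by
      filter_upwards [hT (v t), hR, SchwartzMap.coeFn_toLp (𝓕⁻ (freeEvolution t w hw)) 2 volume,
        SchwartzMap.coeFn_toLp (𝓕⁻ (freeEvolution t (∂_{e} w)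
          (hasCompactSupport_lineDerivOp _ w hw))) 2 volume,
        SchwartzMap.coeFn_toLp (𝓕⁻ (freeEvolution t (coordMul i w hw)
          (hasCompactSupport_coordMul i w hw))) 2 volume] with x h1 h2 h3 h4 h5
      rw [h1, norm_mul, Real.norm_of_nonneg (by positivity)]
      -- Far out `θ` is small. Near the origin `|θ| ≤ 2`, and the propagation estimate applies with
      -- `|x| ≤ |R|`, its constant being large enough since `(2π)² ≥ 1`.
      rcases le_or_gt R ‖x‖ with hx | hx
      · have := mul_le_mul_of_nonneg_right (h2 hx) (norm_nonneg (v t x))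
        have h6 : 0 ≤ α * ‖a t x‖ := by positivity
        have h7 : 0 ≤ β * ‖b t x‖ := by positivity
        linarith
      · have h6 := norm_smul_freeEvolution_le t w hw i x
        rw [← h3, ← h4, ← h5] at h6
        change _ * ‖v t x‖ ≤ _ * ‖a t x‖ + ‖b t x‖ at h6
        have h7 : ‖θ x‖ * ‖v t x‖ ≤ 2 * ‖v t x‖ :=
          mul_le_mul_of_nonneg_right (hθ x) (norm_nonneg _)
        have h8 : 2 * ‖v t x‖ * |t| ≤ 2 * (2 * Real.pi) ^ 2 * |t| * ‖v t x‖ := by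
          have : (1 : ℝ) ≤ (2 * Real.pi) ^ 2 := by nlinarith [Real.pi_gt_three]
          nlinarith [mul_nonneg ht0.le (norm_nonneg (v t x))]
        have h9 : 2 * Real.pi * ‖x‖ * ‖a t x‖ ≤ 2 * Real.pi * |R| * ‖a t x‖ := by
          have : ‖x‖ ≤ |R| := hx.le.trans (le_abs_self R)
          gcongr
        have h10 : 2 * ‖v t x‖ ≤ α * ‖a t x‖ + β * ‖b t x‖ := by
          have : 2 * ‖v t x‖ ≤ (2 * Real.pi * |R| * ‖a t x‖ + ‖b t x‖) / |t| := by
            rw [le_div_iff₀ ht0]; linarith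
          refine this.trans (le_of_eq ?_)
          simp only [α, β]; ring
        have h11 : 0 ≤ δ * ‖v t x‖ := by positivity
        linarith
    have hmemLp : ∀ u : L2 d, MemLp (fun x => ‖u x‖) 2 volume := fun u => (Lp.memLp u).norm
    have hm : ∀ (c : ℝ) (u : L2 d), MemLp (fun x => c * ‖u x‖) 2 volume := fun c u =>
      (hmemLp u).const_mul c
    have hn : ∀ (c : ℝ) (u : L2 d), 0 ≤ c → (eLpNorm (fun x => c * ‖u x‖) 2 volume) =
        ENNReal.ofReal (c * ‖u‖) := by
      intro c u hc
      have := eLpNorm_const_smul c (fun x => ‖u x‖) 2 (volume : Measure (Space d))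
      simp only [eLpNorm_norm] at this
      rw [show (fun x => c * ‖u x‖) = c • (fun x => ‖u x‖) from rfl, this,
        ENNReal.ofReal_mul hc, Real.enorm_of_nonneg hc, ← Lp.enorm_def, ← ofReal_norm]
    have hfin : eLpNorm (T (v t)) 2 volume ≤
        ENNReal.ofReal (δ * Nv + α * Na + β * Nb) := by
      refine (eLpNorm_mono_ae hbound).trans ?_
      refine (eLpNorm_add_le ((hm _ _).1.add (hm _ _).1) (hm _ _).1 one_le_two).trans ?_
      rw [ENNReal.ofReal_add (by positivity) (by positivity), hn β (b t) hβ, hNb]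
      gcongr
      refine (eLpNorm_add_le (hm _ _).1 (hm _ _).1 one_le_two).trans ?_
      rw [ENNReal.ofReal_add (by positivity) (by positivity), hn _ _ hα, hn _ _ hδ0.le, hNa, hNv]
    have h1 : ‖T (v t)‖ ≤ δ * Nv + α * Na + β * Nb := by
      rw [Lp.norm_def]
      exact ENNReal.toReal_le_of_le_ofReal (by positivity) hfin
    have h2 : δ * Nv ≤ ε / 2 := by
      rw [hδ, div_mul_eq_mul_div, div_le_iff₀ (by positivity)]
      nlinarith [norm_nonneg ((coordMul i w hw).toLp 2 (volume : Measure (Space d)))]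
    have h3 : α * Na + β * Nb = (2 * Real.pi * |R| * Na + Nb) / |t| := by
      simp only [α, β]; ring
    linarith
  have hKtop : K = ⊤ := by
    have : CompleteSpace K := hK.completeSpace_coe
    rw [← Submodule.orthogonal_eq_bot_iff, Submodule.eq_bot_iff]
    intro g hg
    exact eq_zero_of_inner_fourierInv_coordMul i g fun w hw =>
      (Submodule.mem_orthogonal K g).1 hg _ (hmem w hw)
  have : f ∈ K := hKtop ▸ Submodule.mem_top
  exact this

end LocalDecay

/-! ### Weak gradients and mollification. -/

noncomputable section Mollification

variable {d : ℕ}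

/-- `B = ∇φ` in the sense of distributions. -/
def IsWeakGradient (φ : Space d → ℝ) (B : Space d → Space d) : Prop :=
  ∀ (j : Fin d) (χ : Space d → ℝ), IsTest χ →
    ∫ x, φ x * partialDeriv j χ x = -∫ x, B x j * χ x

/-- The convolution of `f` and `η`. -/
def mollify (η f : Space d → ℝ) (x : Space d) : ℝ := ∫ t, f t * η (x - t)

lemma mollify_eq (η f : Space d → ℝ) :
    mollify η f = convolution f η (ContinuousLinearMap.lsmul ℝ ℝ) volume := rfl

lemma IsTest.comp_sub {η : Space d → ℝ} (hη : IsTest η) (x : Space d) :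
    IsTest fun t => η (t - x) :=
  ⟨hη.1.comp (contDiff_id.sub contDiff_const), hη.2.comp_homeomorph (Homeomorph.subRight x)⟩

lemma IsTest.comp_sub_left {η : Space d → ℝ} (hη : IsTest η) (x : Space d) :
    IsTest fun t => η (x - t) :=
  ⟨hη.1.comp (contDiff_const.sub contDiff_id), hη.2.comp_homeomorph (Homeomorph.subLeft x)⟩

lemma IsTest.differentiable {η : Space d → ℝ} (hη : IsTest η) : Differentiable ℝ η :=
  hη.1.differentiable (by simp)

lemma partialDeriv_comp_sub {η : Space d → ℝ} (x : Space d) (j : Fin d)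
    (t : Space d) : partialDeriv j (fun t => η (t - x)) t = partialDeriv j η (t - x) := by
  rw [partialDeriv, fderiv_comp_sub, partialDeriv]

lemma partialDeriv_comp_sub_left {η : Space d → ℝ} (hη : IsTest η) (x : Space d) (j : Fin d)
    (t : Space d) : partialDeriv j (fun t => η (x - t)) t = -partialDeriv j η (x - t) := by
  have h1 : HasFDerivAt (fun t => η (x - t))
      ((fderiv ℝ η (x - t)).comp (-ContinuousLinearMap.id ℝ (Space d))) t :=
    (hη.differentiable (x - t)).hasFDerivAt.comp t ((hasFDerivAt_id t).const_sub x)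
  rw [partialDeriv, h1.fderiv, partialDeriv]
  simp

lemma IsTest.continuous_partialDeriv {η : Space d → ℝ} (hη : IsTest η) (j : Fin d) :
    Continuous (partialDeriv j η) :=
  (hη.1.continuous_fderiv (by simp)).clm_apply continuous_const

lemma IsTest.hasCompactSupport_partialDeriv {η : Space d → ℝ} (hη : IsTest η) (j : Fin d) :
    HasCompactSupport (partialDeriv j η) :=
  (hη.2.fderiv ℝ).comp_left (g := fun L : Space d →L[ℝ] ℝ => L (EuclideanSpace.single j 1)) rfl

lemma contDiff_mollify {η f : Space d → ℝ} (hη : IsTest η) (hf : LocallyIntegrable f) :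
    ContDiff ℝ ∞ (mollify η f) := by
  rw [mollify_eq]
  exact hη.2.contDiff_convolution_right _ hf hη.1

lemma fderiv_mollify {η f : Space d → ℝ} (hη : IsTest η) (hf : LocallyIntegrable f)
    (x v : Space d) : fderiv ℝ (mollify η f) x v = ∫ t, f t * fderiv ℝ η (x - t) v := by
  have h1 := hη.2.hasFDerivAt_convolution_right (ContinuousLinearMap.lsmul ℝ ℝ) hf
    (hη.1.of_le (by exact_mod_cast le_top)) x
  rw [mollify_eq, h1.fderiv, convolution_precompR_apply _ hf (hη.2.fderiv ℝ)
    (hη.1.continuous_fderiv (by simp))]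
  rfl

/-- The weak equation is tested against `t ↦ η (x - t)`; the sign from the reflection cancels the
sign of integration by parts. -/
lemma IsWeakGradient.partialDeriv_mollify {φ : Space d → ℝ} {B : Space d → Space d}
    (h : IsWeakGradient φ B) {η : Space d → ℝ} (hη : IsTest η) (hφ : LocallyIntegrable φ)
    (j : Fin d) (x : Space d) :
    partialDeriv j (mollify η φ) x = mollify η (fun t => B t j) x := by
  have h1 := h j _ (hη.comp_sub_left x)
  simp only [partialDeriv_comp_sub_left hη, mul_neg, integral_neg, neg_inj] at h1
  rw [partialDeriv, fderiv_mollify hη hφ]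
  exact h1

/-- A sequence of mollifiers. -/
def stdBump (n : ℕ) : ContDiffBump (0 : Space d) where
  -- The fixed ratio `rOut = 2 rIn` keeps the bumps comparable to averages over balls, as the
  -- Lebesgue differentiation argument in `ae_tendsto_mollify` requires.
  rIn := 1 / (2 * (n + 1))
  rOut := 1 / (n + 1)
  rIn_pos := by positivity
  rIn_lt_rOut := by
    have : (0 : ℝ) < n + 1 := by positivity
    rw [div_lt_div_iff₀ (by positivity) this]; linarith

/-- The normalised bump functions `stdBump n`. -/
def stdMollifier (n : ℕ) : Space d → ℝ := (stdBump n).normed volume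

lemma isTest_stdMollifier (n : ℕ) : IsTest (stdMollifier n : Space d → ℝ) :=
  ⟨(stdBump n).contDiff_normed, (stdBump n).hasCompactSupport_normed⟩

lemma tendsto_rOut_stdBump : Tendsto (fun n => (stdBump n : ContDiffBump (0 : Space d)).rOut)
    atTop (𝓝 0) := tendsto_one_div_add_atTop_nhds_zero_nat

lemma ae_tendsto_mollify {f : Space d → ℝ} (hf : LocallyIntegrable f) :
    ∀ᵐ x, Tendsto (fun n => mollify (stdMollifier n) f x) atTop (𝓝 (f x)) := by
  have h := ContDiffBump.ae_convolution_tendsto_right_of_locallyIntegrable (K := 2)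
    (φ := fun n => (stdBump n : ContDiffBump (0 : Space d))) (l := atTop)
    tendsto_rOut_stdBump (Eventually.of_forall fun n => by
      change 1 / ((n : ℝ) + 1) ≤ 2 * (1 / (2 * (n + 1)))
      refine le_of_eq ?_
      have : (n : ℝ) + 1 ≠ 0 := by positivity
      field_simp) hf
  filter_upwards [h] with x hx
  refine hx.congr fun n => ?_
  rw [convolution_lsmul_swap]
  simp only [mollify, stdMollifier, smul_eq_mul, mul_comm]

/-- A locally integrable function with vanishing distributional gradient is constant. -/
lemma IsWeakGradient.exists_ae_eq_const {ψ : Space d → ℝ} (hψ : LocallyIntegrable ψ)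
    (h : IsWeakGradient ψ 0) : ∃ c, ∀ᵐ x, ψ x = c := by
  -- Mollifications are smooth with zero classical gradient, hence constant; they converge to `ψ`
  -- almost everywhere.
  have hconst : ∀ n x y, mollify (stdMollifier n) ψ x = mollify (stdMollifier n) ψ y := by
    intro n
    refine is_const_of_fderiv_eq_zero
      ((contDiff_mollify (isTest_stdMollifier n) hψ).differentiable (by simp)) fun x => ?_
    refine ContinuousLinearMap.coe_injective ((EuclideanSpace.basisFun (Fin d) ℝ).toBasis.ext
      fun j => ?_)
    have := h.partialDeriv_mollify (isTest_stdMollifier n) hψ j x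
    simpa [partialDeriv, mollify] using this
  have hae := ae_tendsto_mollify hψ
  obtain ⟨x₀, hx₀⟩ := hae.exists
  refine ⟨ψ x₀, ?_⟩
  filter_upwards [hae] with x hx
  exact tendsto_nhds_unique hx (hx₀.congr fun n => hconst n x₀ x)

end Mollification

/-! ### Integrals of short-range functions over rays. -/

noncomputable section RayIntegral

variable {d : ℕ}

/-- `b` is a measurable locally integrable function with `|b x| ≤ C |x|^{-ρ}` for `|x| ≥ R`. -/
structure IsShortRange (b : Space d → ℝ) (C R ρ : ℝ) : Prop where
  measurable : Measurable b
  locallyIntegrable : LocallyIntegrable b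
  one_le : 1 ≤ R
  nonneg : 0 ≤ C
  bound : ∀ x, R ≤ ‖x‖ → |b x| ≤ C * ‖x‖ ^ (-ρ)

/-- The integral of `b` over the ray from `x` in the direction of `e`. -/
def rayIntegral (b : Space d → ℝ) (e x : Space d) : ℝ := ∫ τ in Set.Ioi (0 : ℝ), b (x + τ • e)

variable {b : Space d → ℝ} {C R ρ : ℝ} {e : Space d}

lemma integrableOn_comp_add {b : Space d → ℝ} (hb : LocallyIntegrable b) (r : ℝ) (v : Space d) :
    IntegrableOn (fun x => b (x + v)) (Metric.closedBall 0 r) ∧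
      ∫ x in Metric.closedBall 0 r, |b (x + v)| ≤
        ∫ x in Metric.closedBall 0 (r + ‖v‖), |b x| := by
  have hsub : Metric.closedBall 0 r ⊆ (fun x => x + v) ⁻¹' Metric.closedBall 0 (r + ‖v‖) := by
    intro x hx
    simp only [Metric.mem_closedBall, dist_zero_right, Set.mem_preimage] at hx ⊢
    exact (norm_add_le _ _).trans (by linarith)
  have hmp := measurePreserving_add_right (volume : Measure (Space d)) v
  have hemb : MeasurableEmbedding (fun x : Space d => x + v) := measurableEmbedding_addRight v
  have h1 : IntegrableOn b (Metric.closedBall 0 (r + ‖v‖)) :=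
    hb.integrableOn_isCompact (isCompact_closedBall _ _)
  have h2 : IntegrableOn (fun x => b (x + v))
      ((fun x => x + v) ⁻¹' Metric.closedBall 0 (r + ‖v‖)) :=
    (hmp.integrableOn_comp_preimage hemb).2 h1
  refine ⟨h2.mono_set hsub, ?_⟩
  rw [← hmp.setIntegral_preimage_emb hemb (fun x => |b x|)]
  exact setIntegral_mono_set h2.abs (Eventually.of_forall fun x => abs_nonneg _)
    hsub.eventuallyLE

namespace IsShortRange

lemma bound_ray (hb : IsShortRange b C R ρ) (hρ : 1 < ρ) (he : ‖e‖ = 1) {r τ : ℝ}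
    (hτ : r + R ≤ τ) {x : Space d} (hx : x ∈ Metric.closedBall 0 r) :
    |b (x + τ • e)| ≤ C * (τ - r) ^ (-ρ) := by
  have hR := hb.one_le
  have hx' : ‖x‖ ≤ r := by simpa using hx
  have h0 : 0 ≤ τ := by linarith [norm_nonneg x]
  have h1 : τ - r ≤ ‖x + τ • e‖ := by
    have := norm_sub_le (x + τ • e) x
    rw [add_sub_cancel_left, norm_smul, he, mul_one, Real.norm_of_nonneg h0] at this
    linarith
  refine (hb.bound _ (by linarith)).trans (mul_le_mul_of_nonneg_left ?_ hb.nonneg)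
  exact Real.rpow_le_rpow_of_nonpos (by linarith) h1 (by linarith)

/-- Tonelli: for `τ ≤ r + R` the translated balls stay in one larger ball, where `b` is integrable;
for larger `τ` the decay gives `O((τ - r)^{-ρ})`, which is integrable because `ρ > 1`. -/
lemma integrable_ray (hb : IsShortRange b C R ρ) (hρ : 1 < ρ) (he : ‖e‖ = 1) {r : ℝ}
    (hr : 0 ≤ r) :
    Integrable (fun p : Space d × ℝ => b (p.1 + p.2 • e))
      ((volume.restrict (Metric.closedBall 0 r)).prod (volume.restrict (Set.Ioi 0))) := by
  have hmeas : Measurable (fun p : Space d × ℝ => b (p.1 + p.2 • e)) :=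
    hb.measurable.comp (by fun_prop)
  have hR := hb.one_le
  rw [integrable_prod_iff' hmeas.aestronglyMeasurable]
  refine ⟨Eventually.of_forall fun τ => (integrableOn_comp_add hb.locallyIntegrable r (τ • e)).1, ?_⟩
  have hm : AEStronglyMeasurable
      (fun τ => ∫ x in Metric.closedBall 0 r, ‖b (x + τ • e)‖) (volume : Measure ℝ) := by
    have : Measurable (fun p : ℝ × Space d => ‖b (p.2 + p.1 • e)‖) :=
      (hb.measurable.comp (by fun_prop)).norm
    exact (this.stronglyMeasurable.integral_prod_right').aestronglyMeasurable
  have hsplit : Set.Ioi (0 : ℝ) = Set.Ioc 0 (r + R) ∪ Set.Ioi (r + R) :=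
    (Set.Ioc_union_Ioi_eq_Ioi (by linarith)).symm
  change IntegrableOn (fun τ : ℝ => ∫ x in Metric.closedBall 0 r, ‖b (x + τ • e)‖)
    (Set.Ioi 0) volume
  rw [hsplit]
  refine IntegrableOn.union ?_ ?_
  · refine Measure.integrableOn_of_bounded 
      (M := ∫ x in Metric.closedBall (0 : Space d) (r + (r + R)), |b x|) (by simp) hm ?_
    refine (ae_restrict_iff' measurableSet_Ioc).2 (Eventually.of_forall fun τ hτ => ?_)
    rw [Real.norm_of_nonneg (integral_nonneg fun x => norm_nonneg _)]
    refine (integrableOn_comp_add hb.locallyIntegrable r (τ • e)).2.trans ?_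
    refine setIntegral_mono_set
      (hb.locallyIntegrable.integrableOn_isCompact (isCompact_closedBall _ _)).abs
      (Eventually.of_forall fun x => abs_nonneg _)
      (Metric.closedBall_subset_closedBall ?_).eventuallyLE
    rw [norm_smul, he, mul_one, Real.norm_of_nonneg hτ.1.le]
    linarith [hτ.2]
  · have h1 : IntegrableOn (fun τ : ℝ => volume.real (Metric.closedBall (0 : Space d) r) *
        (C * (τ - r) ^ (-ρ))) (Set.Ioi (r + R)) := by
      have := integrableOn_add_rpow_Ioi_of_lt (a := -ρ) (c := r + R) (m := -r) (by linarith)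
        (by linarith)
      exact (this.const_mul C).const_mul _
    refine Integrable.mono' h1 hm.restrict ?_
    refine (ae_restrict_iff' measurableSet_Ioi).2 (Eventually.of_forall fun τ hτ => ?_)
    have h2 := norm_setIntegral_le_of_norm_le_const (μ := volume)
      (s := Metric.closedBall (0 : Space d) r) (f := fun x => ‖b (x + τ • e)‖)
      (C := C * (τ - r) ^ (-ρ)) measure_closedBall_lt_top
      (fun x hx => by rw [norm_norm]; exact hb.bound_ray hρ he (le_of_lt hτ) hx)
    rwa [mul_comm] at h2

lemma locallyIntegrable_rayIntegral (hb : IsShortRange b C R ρ) (hρ : 1 < ρ) (he : ‖e‖ = 1) :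
    LocallyIntegrable (rayIntegral b e) := by
  rw [locallyIntegrable_iff]
  intro K hK
  obtain ⟨r, hr⟩ := hK.isBounded.subset_closedBall 0
  have h1 := (hb.integrable_ray hρ he (le_max_right r 0)).integral_prod_left
  exact IntegrableOn.mono_set h1
    (hr.trans (Metric.closedBall_subset_closedBall (le_max_left _ _)))

/-- If `⟪x, e⟫ ≥ -1`, then the integral over the ray from `x` is small. -/
lemma abs_rayIntegral_le (hb : IsShortRange b C R ρ) (hρ : 1 < ρ) (he : ‖e‖ = 1) {x : Space d}
    (hx : -1 ≤ ⟪x, e⟫_ℝ) (hxR : 4 * R ≤ ‖x‖) :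
    |rayIntegral b e x| ≤ C * 3 ^ ρ / (ρ - 1) * ‖x‖ ^ (1 - ρ) := by
  have hR := hb.one_le
  have hx0 : 0 < ‖x‖ := by linarith
  have key : ∀ τ : ℝ, 0 < τ → |b (x + τ • e)| ≤ C * 3 ^ ρ * (τ + ‖x‖) ^ (-ρ) := by
    intro τ hτ
    have h1 : ‖x + τ • e‖ ^ 2 = ‖x‖ ^ 2 + 2 * τ * ⟪x, e⟫_ℝ + τ ^ 2 := by
      rw [norm_add_sq_real, inner_smul_right, norm_smul, he, Real.norm_of_nonneg hτ.le]; ring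
    -- The ray stays away from the origin: `|x + τe|² ≥ |x|² - 2τ + τ²`, and `|x| ≥ 4` absorbs the
    -- term `2τ`. Allowing `-1` instead of `0` in the hypothesis makes the half-spaces of opposite
    -- rays overlap in a slab of positive measure.
    have h2 : (τ + ‖x‖) / 3 ≤ ‖x + τ • e‖ := by
      refine le_of_sq_le_sq ?_ (norm_nonneg _)
      rw [h1]
      nlinarith [sq_nonneg (τ - ‖x‖), sq_nonneg (3 * τ - 4)]
    refine (hb.bound _ (by linarith)).trans ?_
    rw [mul_assoc]
    refine mul_le_mul_of_nonneg_left ?_ hb.nonneg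
    calc ‖x + τ • e‖ ^ (-ρ) ≤ ((τ + ‖x‖) / 3) ^ (-ρ) :=
          Real.rpow_le_rpow_of_nonpos (by positivity) h2 (by linarith)
      _ = _ := by
          rw [Real.div_rpow (by linarith) (by norm_num), Real.rpow_neg (by norm_num : (0 : ℝ) ≤ 3) ρ,
            div_inv_eq_mul, mul_comm]
  have hint : IntegrableOn (fun τ : ℝ => C * 3 ^ ρ * (τ + ‖x‖) ^ (-ρ)) (Set.Ioi 0) :=
    (integrableOn_add_rpow_Ioi_of_lt (by linarith) (by linarith)).const_mul _
  have h3 := norm_integral_le_of_norm_le (f := fun τ => b (x + τ • e)) hint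
    ((ae_restrict_iff' measurableSet_Ioi).2 (Eventually.of_forall fun τ hτ => key τ hτ))
  refine h3.trans (le_of_eq ?_)
  rw [integral_const_mul]
  have h4 : ∫ τ in Set.Ioi (0 : ℝ), (τ + ‖x‖) ^ (-ρ) = ∫ τ in Set.Ioi ‖x‖, τ ^ (-ρ) := by
    have := (measurePreserving_add_right (volume : Measure ℝ) ‖x‖).setIntegral_preimage_emb
      (measurableEmbedding_addRight ‖x‖) (fun τ : ℝ => τ ^ (-ρ)) (Set.Ioi ‖x‖)
    simpa using this
  rw [h4, integral_Ioi_rpow_of_lt (by linarith) hx0, show -ρ + 1 = 1 - ρ by ring,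
    show 1 - ρ = -(ρ - 1) by ring, div_neg, neg_div, neg_neg]
  ring

end IsShortRange

end RayIntegral

/-! ### The gauge function: a potential of `B` vanishing at infinity. -/

noncomputable section GaugeFunction

variable {d : ℕ} {C R ρ : ℝ}

lemma integrable_mul_of_hasCompactSupport {f g : Space d → ℝ} (hf : LocallyIntegrable f)
    (hg : Continuous g) (hg' : HasCompactSupport g) : Integrable fun x => f x * g x := by
  have := hf.integrable_smul_right_of_hasCompactSupport hg hg'
  simpa using this

lemma IsShortRange.const_mul {b : Space d → ℝ} (hb : IsShortRange b C R ρ) {σ : ℝ}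
    (hσ : |σ| = 1) : IsShortRange (fun x => σ * b x) C R ρ where
  measurable := hb.measurable.const_mul σ
  locallyIntegrable := by simpa [Pi.smul_def] using hb.locallyIntegrable.smul σ
  one_le := hb.one_le
  nonneg := hb.nonneg
  bound x hx := by rw [abs_mul, hσ, one_mul]; exact hb.bound x hx

/-- The integral is the convolution of `f` with the reflected kernel `x ↦ χ (-x)`, evaluated at `τ •
e`. -/
lemma hasDerivAt_integral_mul_comp_sub {f : Space d → ℝ} (hf : LocallyIntegrable f)
    {χ : Space d → ℝ} (hχ : IsTest χ) (e : Space d) (τ : ℝ) :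
    HasDerivAt (fun τ : ℝ => ∫ y, f y * χ (y - τ • e))
      (-∫ y, f y * fderiv ℝ χ (y - τ • e) e) τ := by
  have hη : IsTest fun x => χ (0 - x) := hχ.comp_sub_left 0
  have h1 : HasFDerivAt (mollify (fun x => χ (0 - x)) f)
      (fderiv ℝ (mollify (fun x => χ (0 - x)) f) (τ • e)) (τ • e) :=
    ((contDiff_mollify hη hf).differentiable (by simp) _).hasFDerivAt
  have h2 : HasDerivAt (fun τ : ℝ => τ • e) e τ := by
    simpa using (hasDerivAt_id τ).smul_const e
  have h3 := h1.comp_hasDerivAt τ h2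
  rw [fderiv_mollify hη hf] at h3
  have h4 : ∀ t, fderiv ℝ (fun x => χ (0 - x)) (τ • e - t) e = -fderiv ℝ χ (t - τ • e) e := by
    intro t
    have h5 : HasFDerivAt (fun x => χ (0 - x)) ((fderiv ℝ χ (0 - (τ • e - t))).comp
        (-ContinuousLinearMap.id ℝ (Space d))) (τ • e - t) :=
      (hχ.differentiable _).hasFDerivAt.comp _ ((hasFDerivAt_id _).const_sub 0)
    rw [h5.fderiv]
    simp
  simp only [h4, mul_neg, integral_neg] at h3
  refine h3.congr_of_eventuallyEq (Eventually.of_forall fun s => ?_)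
  simp [mollify]

lemma exists_support_subset {χ : Space d → ℝ} (hχ : IsTest χ) :
    ∃ r, 0 ≤ r ∧ tsupport χ ⊆ Metric.closedBall 0 r := by
  obtain ⟨r, hr⟩ := hχ.2.isCompact.isBounded.subset_closedBall 0
  exact ⟨max r 0, le_max_right _ _, hr.trans (Metric.closedBall_subset_closedBall (le_max_left _ _))⟩

lemma setIntegral_mul_eq {f g : Space d → ℝ} {K : Set (Space d)} (hg : ∀ x ∉ K, g x = 0) :
    ∫ x in K, f x * g x = ∫ x, f x * g x :=
  setIntegral_eq_integral_of_forall_compl_eq_zero fun x hx => by rw [hg x hx, mul_zero]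

lemma integral_comp_add_mul (f g : Space d → ℝ) (v : Space d) :
    ∫ x, f (x + v) * g x = ∫ y, f y * g (y - v) := by
  rw [← integral_add_right_eq_self (fun y => f y * g (y - v)) v]
  simp

/-- A curl-free short-range field has the potential given by integrals over parallel rays. -/
lemma isWeakGradient_neg_rayIntegral {B : Space d → Space d} (hρ : 1 < ρ)
    (hB : ∀ k, IsShortRange (fun x => B x k) C R ρ)
    (hcurl : ∀ (j k : Fin d) (χ : Space d → ℝ), IsTest χ →
      ∫ x, B x k * partialDeriv j χ x = ∫ x, B x j * partialDeriv k χ x)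
    (i : Fin d) {σ : ℝ} (hσ : |σ| = 1) :
    IsWeakGradient (fun x => -rayIntegral (fun x => σ * B x i)
      (σ • EuclideanSpace.single i (1 : ℝ)) x) B := by
  intro k χ hχ
  obtain ⟨r, hr0, hr⟩ := exists_support_subset hχ
  set e : Space d := σ • EuclideanSpace.single i (1 : ℝ) with he_def
  have he : ‖e‖ = 1 := by simp [he_def, norm_smul, hσ]
  have hb := (hB i).const_mul hσ
  set b : Space d → ℝ := fun x => σ * B x i
  set g := partialDeriv k χ with hg_def
  have hgc : Continuous g := hχ.continuous_partialDeriv k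
  have hg0 : ∀ x ∉ Metric.closedBall (0 : Space d) r, g x = 0 := by
    intro x hx
    have : fderiv ℝ χ x = 0 :=
      Function.notMem_support.1 fun h => hx (hr (support_fderiv_subset ℝ h))
    simp [hg_def, partialDeriv, this]
  have hχ0 : ∀ x ∉ Metric.closedBall (0 : Space d) r, χ x = 0 := fun x hx =>
    image_eq_zero_of_notMem_tsupport fun h => hx (hr h)
  obtain ⟨Mg, hMg⟩ := hgc.bounded_above_of_compact_support (hχ.hasCompactSupport_partialDeriv k)
  obtain ⟨Mχ, hMχ⟩ := hχ.1.continuous.bounded_above_of_compact_support hχ.2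
  have hint : Integrable (Function.uncurry fun (x : Space d) (τ : ℝ) => b (x + τ • e) * g x)
      ((volume.restrict (Metric.closedBall 0 r)).prod (volume.restrict (Set.Ioi 0))) :=
    (hb.integrable_ray hρ he hr0).mul_bdd (c := Mg)
      (hgc.comp continuous_fst).aestronglyMeasurable (Eventually.of_forall fun p => hMg p.1)
  set G : ℝ → ℝ := fun τ => ∫ y, B y k * χ (y - τ • e) with hG_def
  have hF : ∀ τ : ℝ, ∫ x in Metric.closedBall 0 r, b (x + τ • e) * g x =
      ∫ y, B y k * fderiv ℝ χ (y - τ • e) e := by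
    intro τ
    -- The curl condition, tested on a translate of `χ`, exchanges `B_i ∂_k χ` for `B_k ∂_i χ`; the
    -- latter is a derivative along the ray, and `σ` is absorbed into `e`.
    have h1 := hcurl i k _ (hχ.comp_sub (τ • e))
    simp only [partialDeriv_comp_sub] at h1
    rw [setIntegral_mul_eq (f := fun x => b (x + τ • e)) hg0, integral_comp_add_mul]
    simp only [b, mul_assoc]
    rw [integral_const_mul, ← h1, ← integral_const_mul]
    refine integral_congr_ae (Eventually.of_forall fun y => ?_)
    simp only [he_def, map_smul, smul_eq_mul, partialDeriv]
    ring
  have hG : ∀ τ : ℝ, HasDerivAt G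
      (-∫ x in Metric.closedBall 0 r, b (x + τ • e) * g x) τ := by
    intro τ
    rw [hF]
    exact hasDerivAt_integral_mul_comp_sub (hB k).locallyIntegrable hχ e τ
  -- For large `τ` the translated support of `χ` lies where `B` is `O((τ - r)^{-ρ})`.
  have hGlim : Tendsto G atTop (𝓝 0) := by
    have hz : Tendsto (fun τ : ℝ => C * (τ - r) ^ (-ρ) * Mχ *
        volume.real (Metric.closedBall (0 : Space d) r)) atTop (𝓝 0) := by
      have h1 : Tendsto (fun τ : ℝ => (τ - r) ^ (-ρ)) atTop (𝓝 0) :=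
        (tendsto_rpow_neg_atTop (by linarith)).comp (tendsto_atTop_add_const_right _ (-r) tendsto_id)
      simpa using ((h1.const_mul C).mul_const Mχ).mul_const _
    refine squeeze_zero_norm' ?_ hz
    filter_upwards [eventually_ge_atTop (r + R)] with τ hτ
    have h1 : G τ = ∫ x in Metric.closedBall 0 r, B (x + τ • e) k * χ x := by
      rw [setIntegral_mul_eq (f := fun x => B (x + τ • e) k) hχ0,
        integral_comp_add_mul (fun x => B x k)]
    rw [h1]
    refine norm_setIntegral_le_of_norm_le_const measure_closedBall_lt_top fun x hx => ?_
    rw [norm_mul]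
    have := (hB k).bound_ray hρ he hτ hx
    exact mul_le_mul this (hMχ x) (norm_nonneg _) ((abs_nonneg _).trans this)
  have hFint : IntegrableOn (fun τ : ℝ => -∫ x in Metric.closedBall 0 r, b (x + τ • e) * g x)
      (Set.Ioi 0) := (Integrable.integral_prod_right hint).neg
  -- The boundary term at infinity vanishes, so the integral over all `τ` reduces to `G 0 = ∫ B_k
  -- χ`.
  have hFTC := integral_Ioi_of_hasDerivAt_of_tendsto' (fun τ _ => hG τ) hFint hGlim
  rw [integral_neg] at hFTC
  calc ∫ x, -rayIntegral b e x * g x = -∫ x, rayIntegral b e x * g x := by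
        simp only [neg_mul, integral_neg]
    _ = -∫ x in Metric.closedBall 0 r, ∫ τ in Set.Ioi (0 : ℝ), b (x + τ • e) * g x := by
        rw [← setIntegral_mul_eq hg0]
        simp only [rayIntegral, integral_mul_const]
    _ = -∫ τ in Set.Ioi (0 : ℝ), ∫ x in Metric.closedBall 0 r, b (x + τ • e) * g x := by
        rw [integral_integral_swap hint]
    _ = _ := by
        rw [hFTC]
        simp [G]

/-- A curl-free short-range field in dimension `d ≥ 2` is the gradient of a function which vanishes
at infinity. -/
theorem exists_isWeakGradient {B : Space d → Space d} (hd : 2 ≤ d) (hρ : 1 < ρ)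
    (hB : ∀ k, IsShortRange (fun x => B x k) C R ρ)
    (hcurl : ∀ (j k : Fin d) (χ : Space d → ℝ), IsTest χ →
      ∫ x, B x k * partialDeriv j χ x = ∫ x, B x j * partialDeriv k χ x) :
    ∃ φ : Space d → ℝ, LocallyIntegrable φ ∧ IsWeakGradient φ B ∧
      ∀ ε > 0, ∃ r, ∀ᵐ x, r ≤ ‖x‖ → |φ x| ≤ ε := by
  obtain ⟨i, j, hij⟩ : ∃ i j : Fin d, i ≠ j :=
    ⟨⟨0, by omega⟩, ⟨1, by omega⟩, by simp [Fin.ext_iff]⟩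
  have hone : |(1 : ℝ)| = 1 := abs_one
  have hneg : |(-1 : ℝ)| = 1 := by simp
  set φ : ℝ → Space d → ℝ := fun σ x => -rayIntegral (fun x => σ * B x i)
      (σ • EuclideanSpace.single i (1 : ℝ)) x with hφ_def
  have he : ∀ σ : ℝ, |σ| = 1 → ‖σ • EuclideanSpace.single i (1 : ℝ)‖ = 1 := by
    intro σ hσ; simp [norm_smul, hσ]
  have hloc : ∀ σ : ℝ, |σ| = 1 → LocallyIntegrable (φ σ) := fun σ hσ =>
    (((hB i).const_mul hσ).locallyIntegrable_rayIntegral hρ (he σ hσ)).neg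
  have hgrad : ∀ σ : ℝ, |σ| = 1 → IsWeakGradient (φ σ) B := fun σ hσ =>
    isWeakGradient_neg_rayIntegral hρ hB hcurl i hσ
  have hdecay : ∀ ε > 0, ∃ r, ∀ σ : ℝ, |σ| = 1 → ∀ x : Space d, -1 ≤ σ * x i → r ≤ ‖x‖ →
      |φ σ x| ≤ ε := by
    intro ε hε
    have hlim : Tendsto (fun s : ℝ => C * 3 ^ ρ / (ρ - 1) * s ^ (1 - ρ)) atTop (𝓝 0) := by
      have := tendsto_rpow_neg_atTop (y := ρ - 1) (by linarith)
      rw [neg_sub] at this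
      simpa using this.const_mul (C * 3 ^ ρ / (ρ - 1))
    obtain ⟨r, hr⟩ := eventually_atTop.1 (hlim.eventually_lt_const hε)
    refine ⟨max r (4 * R), fun σ hσ x hx hxr => ?_⟩
    have h1 := ((hB i).const_mul hσ).abs_rayIntegral_le hρ (he σ hσ) (x := x)
      (by simpa [inner_smul_right, EuclideanSpace.inner_single_right] using hx)
      ((le_max_right _ _).trans hxr)
    rw [hφ_def, abs_neg]
    exact h1.trans (hr _ ((le_max_left _ _).trans hxr)).le
  have hdiff : IsWeakGradient (fun x => φ 1 x - φ (-1) x) 0 := by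
    intro k χ hχ
    have h1 := hgrad 1 hone k χ hχ
    have h2 := hgrad (-1) hneg k χ hχ
    simp only [sub_mul]
    rw [integral_sub, h1, h2]
    · simp
    · exact integrable_mul_of_hasCompactSupport (hloc 1 hone) (hχ.continuous_partialDeriv k)
        (hχ.hasCompactSupport_partialDeriv k)
    · exact integrable_mul_of_hasCompactSupport (hloc _ hneg) (hχ.continuous_partialDeriv k)
        (hχ.hasCompactSupport_partialDeriv k)
  obtain ⟨c, hc⟩ := hdiff.exists_ae_eq_const ((hloc 1 hone).sub (hloc _ hneg))
  -- Both potentials are at most `|c| / 3` far out in the slab `|xᵢ| ≤ 1`. The second direction `j ≠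
  -- i` supplies a unit ball there; a set of positive measure is needed because the difference
  -- equals `c` only almost everywhere.
  have hc0 : c = 0 := by
    by_contra hne
    obtain ⟨r, hr⟩ := hdecay (|c| / 3) (by positivity)
    set y : Space d := EuclideanSpace.single j (|r| + 1) with hy
    have hpos : 0 < volume (Metric.ball y 1) := Metric.measure_ball_pos _ _ one_pos
    obtain ⟨x, hx, hxc⟩ : ∃ x ∈ Metric.ball y 1, φ 1 x - φ (-1) x = c := by
      by_contra hcon
      push Not at hcon
      exact hpos.ne' (measure_mono_null (fun x hx => hcon x hx) (ae_iff.1 hc))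
    have hxy : ‖x - y‖ < 1 := by simpa [dist_eq_norm] using hx
    have hxi : |x i| ≤ 1 := by
      have h1 := (PiLp.norm_apply_le (x - y) i).trans hxy.le
      have h2 : y i = 0 := by simp [hy, hij]
      simpa [h2] using h1
    have hxr : r ≤ ‖x‖ := by
      have h1 := norm_sub_norm_le y x
      rw [norm_sub_rev y x] at h1
      have h2 : ‖y‖ = |r| + 1 := by
        rw [hy, PiLp.norm_single, Real.norm_of_nonneg (by positivity)]
      linarith [le_abs_self r]
    have h1 := hr 1 hone x (by linarith [(abs_le.1 hxi).1]) hxr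
    have h2 := hr (-1) hneg x (by linarith [(abs_le.1 hxi).2]) hxr
    have h3 : |c| ≤ |φ 1 x| + |φ (-1) x| := by rw [← hxc]; exact abs_sub _ _
    have h4 : 0 < |c| := abs_pos.2 hne
    linarith
  refine ⟨φ 1, hloc 1 hone, hgrad 1 hone, fun ε hε => ?_⟩
  obtain ⟨r, hr⟩ := hdecay ε hε
  refine ⟨r, ?_⟩
  filter_upwards [hc] with x hx hxr
  -- The ray whose direction matches the sign of `xᵢ` avoids the origin; the two potentials agree
  -- almost everywhere, so either may be estimated.
  rcases le_total 0 (x i) with h | h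
  · exact hr 1 hone x (by linarith) hxr
  · have : φ 1 x = φ (-1) x := by
      change φ 1 x - φ (-1) x = c at hx
      linarith
    rw [this]
    exact hr (-1) hneg x (by linarith) hxr

end GaugeFunction

/-! ### Mollification in `L²_loc`. -/

noncomputable section GaugeCovariance

open scoped ENNReal

variable {d : ℕ}

lemma tendsto_eLpNorm_comp_sub {f : Space d → ℝ} (hf : MemLp f 2) :
    Tendsto (fun h => eLpNorm (fun x => f (x - h) - f x) 2 volume) (𝓝 0) (𝓝 0) := by
  let g : C(Space d, C(Space d, Space d)) :=
    (ContinuousMap.mk (fun p : Space d × Space d => p.2 - p.1) (by fun_prop)).curry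
  have hg : ∀ h, MeasurePreserving (g h) (volume : Measure (Space d)) volume := fun h =>
    measurePreserving_sub_right volume h
  have hg0 : g 0 = ContinuousMap.id _ := by ext; simp [g]
  have hc : Continuous fun h => Lp.compMeasurePreserving (g h) (hg h) (hf.toLp f) :=
    continuous_const.compMeasurePreservingLp g.continuous hg (by simp)
  have h1 : Tendsto (fun h => ‖Lp.compMeasurePreserving (g h) (hg h) (hf.toLp f) - hf.toLp f‖ₑ)
      (𝓝 0) (𝓝 0) := by
    have h2 : Lp.compMeasurePreserving (g 0) (hg 0) (hf.toLp f) = hf.toLp f := by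
      refine Lp.ext ?_
      filter_upwards [Lp.coeFn_compMeasurePreserving (hf.toLp f) (hg 0)] with x hx
      rw [hx]; simp [hg0]
    have h3 := (hc.sub continuous_const).enorm.tendsto (x := 0) (f := fun h =>
      ‖Lp.compMeasurePreserving (g h) (hg h) (hf.toLp f) - hf.toLp f‖ₑ)
    simpa [h2] using h3
  refine h1.congr fun h => ?_
  rw [Lp.enorm_def]
  refine eLpNorm_congr_ae ?_
  have h4 := (hg h).quasiMeasurePreserving.ae_eq_comp hf.coeFn_toLp
  filter_upwards [Lp.coeFn_sub (Lp.compMeasurePreserving (g h) (hg h) (hf.toLp f)) (hf.toLp f),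
    Lp.coeFn_compMeasurePreserving (hf.toLp f) (hg h), hf.coeFn_toLp, h4] with x h1 h2 h3 h4
  rw [h1, Pi.sub_apply, h2, h3, h4]
  rfl

/-- `f ∈ L²_loc`. -/
def LocallyL2 (f : Space d → ℝ) : Prop :=
  ∀ K : Set (Space d), IsCompact K → MemLp f 2 (volume.restrict K)

lemma LocallyL2.locallyIntegrable {f : Space d → ℝ} (hf : LocallyL2 f) : LocallyIntegrable f := by
  rw [locallyIntegrable_iff]
  intro K hK
  have : IsFiniteMeasure (volume.restrict K) := ⟨by simpa using hK.measure_lt_top⟩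
  exact (hf K hK).integrable one_le_two

lemma support_stdMollifier_subset (n : ℕ) :
    Function.support (stdMollifier n : Space d → ℝ) ⊆ Metric.ball 0 (1 / (n + 1)) := by
  rw [stdMollifier, ContDiffBump.support_normed_eq]
  rfl

lemma stdMollifier_nonneg (n : ℕ) (x : Space d) : 0 ≤ stdMollifier n x :=
  (stdBump n).nonneg_normed x

lemma integral_stdMollifier (n : ℕ) : ∫ x : Space d, stdMollifier n x = 1 :=
  (stdBump n).integral_normed

lemma lintegral_stdMollifier (n : ℕ) : ∫⁻ x : Space d, ‖stdMollifier n x‖ₑ = 1 := by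
  have h1 : Integrable (stdMollifier n : Space d → ℝ) :=
    (isTest_stdMollifier n).1.continuous.integrable_of_hasCompactSupport (isTest_stdMollifier n).2
  rw [← ofReal_integral_norm_eq_lintegral_enorm h1]
  simp only [Real.norm_of_nonneg (stdMollifier_nonneg n _), integral_stdMollifier,
    ENNReal.ofReal_one]

lemma enorm_mollify_sub_le {f : Space d → ℝ} (hf : LocallyIntegrable f) (n : ℕ) (x : Space d) :
    ‖mollify (stdMollifier n) f x - f x‖ₑ ≤
      ∫⁻ h, ‖f (x - h) - f x‖ₑ * ‖stdMollifier n h‖ₑ := by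
  have hη := isTest_stdMollifier (d := d) n
  have h1 : mollify (stdMollifier n) f x = ∫ h, f (x - h) * stdMollifier n h := by
    rw [mollify, ← integral_sub_left_eq_self _ volume x]
    simp
  have h2 : f x = ∫ h : Space d, f x * stdMollifier n h := by
    rw [integral_const_mul, integral_stdMollifier, mul_one]
  have h3 : Integrable fun h => f (x - h) * stdMollifier n h := by
    have := (integrable_mul_of_hasCompactSupport hf (hη.comp_sub_left x).1.continuous
      (hη.comp_sub_left x).2).comp_sub_left x
    simpa using this
  have h4 : Integrable fun h : Space d => f x * stdMollifier n h :=
    (hη.1.continuous.integrable_of_hasCompactSupport hη.2).const_mul _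
  have h5 : mollify (stdMollifier n) f x - f x =
      ∫ h, (f (x - h) * stdMollifier n h - f x * stdMollifier n h) := by
    rw [integral_sub h3 h4, ← h1, ← h2]
  rw [h5]
  refine (enorm_integral_le_lintegral_enorm _).trans (le_of_eq (lintegral_congr fun h => ?_))
  rw [← sub_mul, enorm_mul]

/-- By Tonelli the integral is an average, over `|h| < 1/(n+1)`, of the pairings of `|w|` with `|f(·
- h) - f|`. Cauchy–Schwarz and the continuity of translations in `L²` make these uniformly small. -/
lemma tendsto_lintegral_mul_mollify_sub_of_memLp {f w : Space d → ℝ} (hfm : Measurable f)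
    (hf : MemLp f 2) (hw : MemLp w 2) (hwm : Measurable w) :
    Tendsto (fun n => ∫⁻ x, ‖w x‖ₑ * ‖mollify (stdMollifier n) f x - f x‖ₑ) atTop (𝓝 0) := by
  have hfl : LocallyIntegrable f := hf.locallyIntegrable one_le_two
  have hpair : ∀ h : Space d, ∫⁻ x, ‖w x‖ₑ * ‖f (x - h) - f x‖ₑ ≤
      eLpNorm w 2 volume * eLpNorm (fun x => f (x - h) - f x) 2 volume := by
    intro h
    have hm : AEStronglyMeasurable (fun x => f (x - h) - f x) volume :=
      ((hfm.comp (measurable_id.sub_const h)).sub hfm).aestronglyMeasurable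
    have := eLpNorm_smul_le_mul_eLpNorm (p := 2) (q := 2) (r := 1) hm hw.1
    rw [eLpNorm_one_eq_lintegral_enorm] at this
    simpa [enorm_mul] using this
  have hbound : ∀ (n : ℕ) (c : ℝ≥0∞), (∀ h ∈ Metric.ball (0 : Space d) (1 / (n + 1)),
      eLpNorm (fun x => f (x - h) - f x) 2 volume ≤ c) →
      ∫⁻ x, ‖w x‖ₑ * ‖mollify (stdMollifier n) f x - f x‖ₑ ≤ eLpNorm w 2 volume * c := by
    intro n c hc
    have hηm : Measurable (stdMollifier n : Space d → ℝ) :=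
      (isTest_stdMollifier n).1.continuous.measurable
    calc ∫⁻ x, ‖w x‖ₑ * ‖mollify (stdMollifier n) f x - f x‖ₑ
        ≤ ∫⁻ x, ∫⁻ h, ‖w x‖ₑ * (‖f (x - h) - f x‖ₑ * ‖stdMollifier n h‖ₑ) := by
          refine lintegral_mono fun x => ?_
          refine (mul_le_mul_right (enorm_mollify_sub_le hfl n x) _).trans (le_of_eq ?_)
          rw [lintegral_const_mul]
          exact ((hfm.comp (by fun_prop)).sub_const _).enorm.mul hηm.enorm
      _ = ∫⁻ h, ∫⁻ x, ‖w x‖ₑ * (‖f (x - h) - f x‖ₑ * ‖stdMollifier n h‖ₑ) := by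
          refine lintegral_lintegral_swap (Measurable.aemeasurable ?_)
          exact (hwm.comp measurable_fst).enorm.mul
            (((hfm.comp (by fun_prop)).sub (hfm.comp measurable_fst)).enorm.mul
              (hηm.comp measurable_snd).enorm)
      _ ≤ ∫⁻ h : Space d, eLpNorm w 2 volume * c * ‖stdMollifier n h‖ₑ := by
          refine lintegral_mono fun h => ?_
          simp only [← mul_assoc]
          rw [lintegral_mul_const]
          · by_cases hh : h ∈ Metric.ball (0 : Space d) (1 / (n + 1))
            · gcongr
              exact (hpair h).trans (by gcongr; exact hc h hh)
            · have : stdMollifier n h = 0 :=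
                Function.notMem_support.1 fun h' => hh (support_stdMollifier_subset n h')
              simp [this]
          · exact hwm.enorm.mul ((hfm.comp (by fun_prop)).sub hfm).enorm
      _ = _ := by
          rw [lintegral_const_mul _ hηm.enorm, lintegral_stdMollifier, mul_one]
  rw [ENNReal.tendsto_nhds_zero]
  intro ε hε
  have hlim : Tendsto (fun c : ℝ≥0∞ => eLpNorm w 2 volume * c) (𝓝 0) (𝓝 0) := by
    have := ENNReal.Tendsto.const_mul (a := eLpNorm w 2 volume) (tendsto_id (x := 𝓝 (0 : ℝ≥0∞)))
      (Or.inr hw.2.ne)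
    simpa using this
  obtain ⟨c, hc0, hc⟩ : ∃ c : ℝ≥0∞, 0 < c ∧ eLpNorm w 2 volume * c ≤ ε := by
    have h2 := (ENNReal.tendsto_nhds_zero.1 hlim) ε hε
    rcases ENNReal.nhds_zero_basis.eventually_iff.1 h2 with ⟨a, ha, h3⟩
    obtain ⟨b, hb, hb'⟩ := exists_between ha
    exact ⟨b, hb, h3 hb'⟩
  have h4 := (ENNReal.tendsto_nhds_zero.1 (tendsto_eLpNorm_comp_sub hf)) c hc0
  obtain ⟨δ, hδ, hδ'⟩ := Metric.eventually_nhds_iff_ball.1 h4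
  filter_upwards [tendsto_one_div_add_atTop_nhds_zero_nat.eventually_lt_const hδ] with n hn
  exact (hbound n c fun h hh => hδ' h (Metric.ball_subset_ball hn.le hh)).trans hc

/-- Convergence of mollifications in `L²_loc`, tested against a function of `L²` with bounded
support. -/
lemma tendsto_lintegral_mul_mollify_sub {f w : Space d → ℝ} (hfm : Measurable f)
    (hf : LocallyL2 f) (hwm : Measurable w) (hw : MemLp w 2) {r : ℝ}
    (hw0 : ∀ x ∉ Metric.closedBall (0 : Space d) r, w x = 0) :
    Tendsto (fun n => ∫⁻ x, ‖w x‖ₑ * ‖mollify (stdMollifier n) f x - f x‖ₑ) atTop (𝓝 0) := by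
  -- The mollifiers have radius at most `1`, so on the ball of radius `r` truncating `f` to `K`
  -- changes nothing.
  set K := Metric.closedBall (0 : Space d) (r + 1)
  have hK : MeasurableSet K := Metric.isClosed_closedBall.measurableSet
  have h1 : MemLp (K.indicator f) 2 :=
    (memLp_indicator_iff_restrict hK).2 (hf K (isCompact_closedBall _ _))
  refine (tendsto_lintegral_mul_mollify_sub_of_memLp (hfm.indicator hK) h1 hw hwm).congr fun n =>
    lintegral_congr fun x => ?_
  by_cases hx : x ∈ Metric.closedBall (0 : Space d) r
  · have hxK : x ∈ K := Metric.closedBall_subset_closedBall (by linarith) hx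
    have h2 : mollify (stdMollifier n) (K.indicator f) x = mollify (stdMollifier n) f x := by
      refine integral_congr_ae (Eventually.of_forall fun t => ?_)
      by_cases ht : t ∈ K
      · simp [ht]
      · have : stdMollifier n (x - t) = 0 := by
          refine Function.notMem_support.1 fun h' => ht ?_
          have h3 := support_stdMollifier_subset n h'
          simp only [Metric.mem_ball, dist_zero_right, Metric.mem_closedBall, K] at h3 hx ⊢
          have h4 : (1 : ℝ) / (n + 1) ≤ 1 := by
            rw [div_le_one (by positivity)]; linarith [n.cast_nonneg (α := ℝ)]
          have h5 := norm_sub_norm_le t x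
          rw [norm_sub_rev] at h5
          linarith
        simp [this]
    rw [h2, Set.indicator_of_mem hxK]
  · simp [hw0 x hx]

end GaugeCovariance

/-! ### Gauge covariance of the magnetic gradient. -/

noncomputable section MagneticGradient

open scoped ENNReal

variable {d : ℕ}

/-- Multiplication of complex functions by the phase `e^{iφ}`. -/
def phase (φ : Space d → ℝ) (x : Space d) : ℂ := Complex.exp (φ x * Complex.I)

lemma norm_phase (φ : Space d → ℝ) (x : Space d) : ‖phase φ x‖ = 1 :=
  Complex.norm_exp_ofReal_mul_I _

lemma phase_eq (φ : Space d → ℝ) (x : Space d) :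
    phase φ x = (Real.cos (φ x) : ℂ) + (Real.sin (φ x) : ℂ) * Complex.I := by
  rw [phase, Complex.exp_mul_I, Complex.ofReal_cos, Complex.ofReal_sin]

lemma aestronglyMeasurable_phase {φ : Space d → ℝ} (hφ : AEStronglyMeasurable φ volume) :
    AEStronglyMeasurable (phase φ) volume :=
  (by fun_prop : Continuous fun t : ℝ => Complex.exp (t * Complex.I)).comp_aestronglyMeasurable hφ

lemma integrable_phase_mul {φ : Space d → ℝ} (hφ : AEStronglyMeasurable φ volume)
    {h : Space d → ℂ} (hh : Integrable h) : Integrable fun x => phase φ x * h x :=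
  hh.bdd_mul (c := 1) (aestronglyMeasurable_phase hφ) (Eventually.of_forall fun x => (norm_phase φ x).le)

lemma tendsto_integral_phase_mul {φ : Space d → ℝ} {φn : ℕ → Space d → ℝ}
    (hφn : ∀ n, AEStronglyMeasurable (φn n) volume)
    (hlim : ∀ᵐ x, Tendsto (fun n => φn n x) atTop (𝓝 (φ x))) {h : Space d → ℂ}
    (hh : Integrable h) :
    Tendsto (fun n => ∫ x, phase (φn n) x * h x) atTop (𝓝 (∫ x, phase φ x * h x)) := by
  refine tendsto_integral_of_dominated_convergence (fun x => ‖h x‖)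
    (fun n => (integrable_phase_mul (hφn n) hh).1) hh.norm
    (fun n => Eventually.of_forall fun x => ?_) ?_
  · rw [norm_mul, norm_phase, one_mul]
  · filter_upwards [hlim] with x hx
    refine Tendsto.mul_const _ ?_
    exact ((by fun_prop : Continuous fun t : ℝ => Complex.exp (t * Complex.I)).tendsto _).comp hx

lemma integrable_mul_test (u : L2 d) {g : Space d → ℝ} (hg : Continuous g)
    (hg' : HasCompactSupport g) : Integrable fun x => u x * (g x : ℂ) := by
  have h1 : LocallyIntegrable (u : Space d → ℂ) := (Lp.memLp u).locallyIntegrable one_le_two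
  have := h1.integrable_smul_left_of_hasCompactSupport hg hg'
  refine this.congr (Eventually.of_forall fun x => ?_)
  simp [mul_comm]

lemma LocallyL2.memLp_mul {f : Space d → ℝ} (hf : LocallyL2 f) {g : Space d → ℝ}
    (hg : Continuous g) (hg' : HasCompactSupport g) : MemLp (fun x => f x * g x) 2 := by
  have hK := hg'.isCompact
  have h1 : MemLp (fun x => g x * f x) 2 (volume.restrict (tsupport g)) := by
    obtain ⟨M, hM⟩ := hg.bounded_above_of_compact_support hg'
    refine (hf _ hK).of_le_mul (c := M) (hg.aestronglyMeasurable.mul (hf _ hK).1)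
      (Eventually.of_forall fun x => ?_)
    rw [norm_mul]
    exact mul_le_mul_of_nonneg_right (hM x) (norm_nonneg _)
  rw [← memLp_indicator_iff_restrict (isClosed_tsupport g).measurableSet] at h1
  refine (memLp_congr_ae (Eventually.of_forall fun x => ?_)).1 h1
  by_cases hx : x ∈ tsupport g
  · simp [hx, mul_comm]
  · simp [hx, image_eq_zero_of_notMem_tsupport hx]

lemma LocallyL2.integrable_mul_mul_test {f : Space d → ℝ} (hf : LocallyL2 f) (u : L2 d)
    {g : Space d → ℝ} (hg : Continuous g) (hg' : HasCompactSupport g) :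
    Integrable fun x => (f x : ℂ) * u x * (g x : ℂ) := by
  have h1 : MemLp (fun x => ((f x * g x : ℝ) : ℂ)) 2 volume := (hf.memLp_mul hg hg').ofReal
  refine (h1.integrable_mul (Lp.memLp u)).congr (Eventually.of_forall fun x => ?_)
  simp only [Pi.mul_apply, Complex.ofReal_mul]
  ring

lemma LocallySquareIntegrable.locallyL2 {A : Space d → Space d} (hA : LocallySquareIntegrable A)
    (j : Fin d) : LocallyL2 fun x => A x j := fun K hK =>
  (hA K hK).of_le (((EuclideanSpace.proj (𝕜 := ℝ) j).continuous).comp_aestronglyMeasurable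
    (hA K hK).1) (Eventually.of_forall fun x => PiLp.norm_apply_le (A x) j)

/-- The equation `(i∇ + A) u = g` tested against the function `e^{iθ} χ` with smooth `θ`. -/
lemma HasMagneticGradient.integral_phase {A : Space d → Space d} (hA : LocallySquareIntegrable A)
    {u : L2 d} {g : Fin d → L2 d} (h : HasMagneticGradient A u g) (j : Fin d)
    {χ θ : Space d → ℝ} (hχ : IsTest χ) (hθ : ContDiff ℝ ∞ θ) :
    ∫ x, phase θ x * (g j x * (χ x : ℂ)) =
      ∫ x, (phase θ x * (-(Complex.I * u x * (partialDeriv j χ x : ℂ)) +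
          (A x j : ℂ) * u x * (χ x : ℂ)) +
        phase θ x * (u x * ((χ x * partialDeriv j θ x : ℝ) : ℂ))) := by
  have hθd : Differentiable ℝ θ := hθ.differentiable (by simp)
  -- Test functions are real, so `e^{iθ} χ` enters through its real and imaginary parts.
  have hc : IsTest fun x => Real.cos (θ x) * χ x :=
    ⟨(Real.contDiff_cos.comp hθ).mul hχ.1, hχ.2.mul_left⟩
  have hs : IsTest fun x => Real.sin (θ x) * χ x :=
    ⟨(Real.contDiff_sin.comp hθ).mul hχ.1, hχ.2.mul_left⟩
  have hdc : ∀ x, partialDeriv j (fun x => Real.cos (θ x) * χ x) x =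
      Real.cos (θ x) * partialDeriv j χ x - Real.sin (θ x) * (χ x * partialDeriv j θ x) := by
    intro x
    have h1 := ((hθd x).hasFDerivAt.cos.mul (hχ.differentiable x).hasFDerivAt).fderiv
    rw [partialDeriv]
    erw [h1]
    simp [partialDeriv]; ring
  have hds : ∀ x, partialDeriv j (fun x => Real.sin (θ x) * χ x) x =
      Real.sin (θ x) * partialDeriv j χ x + Real.cos (θ x) * (χ x * partialDeriv j θ x) := by
    intro x
    have h1 := ((hθd x).hasFDerivAt.sin.mul (hχ.differentiable x).hasFDerivAt).fderiv
    rw [partialDeriv]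
    erw [h1]
    simp [partialDeriv]; ring
  have hL : ∀ {η : Space d → ℝ}, IsTest η → Integrable fun x => g j x * (η x : ℂ) :=
    fun hη => integrable_mul_test _ hη.1.continuous hη.2
  have hR : ∀ {η : Space d → ℝ}, IsTest η → Integrable fun x =>
      (-(Complex.I * u x * (partialDeriv j η x : ℂ)) + (A x j : ℂ) * u x * (η x : ℂ)) := by
    intro η hη
    refine Integrable.add ?_ ((hA.locallyL2 j).integrable_mul_mul_test u hη.1.continuous hη.2)
    have := (integrable_mul_test u (hη.continuous_partialDeriv j)
      (hη.hasCompactSupport_partialDeriv j)).const_mul (-Complex.I)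
    refine this.congr (Eventually.of_forall fun x => ?_)
    simp only; ring
  have e1 := h j _ hc
  have e2 := congrArg (fun z => z * Complex.I) (h j _ hs)
  simp only [← integral_mul_const] at e2
  calc _ = ∫ x, (g j x * ((Real.cos (θ x) * χ x : ℝ) : ℂ) +
        g j x * ((Real.sin (θ x) * χ x : ℝ) : ℂ) * Complex.I) := by
        refine integral_congr_ae (Eventually.of_forall fun x => ?_)
        simp only [phase_eq, Complex.ofReal_mul]; ring
    _ = _ := by
        rw [integral_add (hL hc) ((hL hs).mul_const _), e1, e2,
          ← integral_add (hR hc) ((hR hs).mul_const _)]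
        refine integral_congr_ae (Eventually.of_forall fun x => ?_)
        simp only [hdc, hds, phase_eq, Complex.ofReal_mul, Complex.ofReal_add, Complex.ofReal_sub]
        linear_combination (-u x * (χ x * partialDeriv j θ x) * Real.cos (θ x)) * Complex.I_sq

/-- Gauge covariance: `(i∇ + A + ∇φ)(e^{iφ} u) = e^{iφ} (i∇ + A) u`. -/
theorem HasMagneticGradient.gauge {A A' B : Space d → Space d} (hA : LocallySquareIntegrable A)
    (hB : ∀ j, LocallyL2 fun x => B x j) (hBm : ∀ j, Measurable fun x => B x j)
    (hAB : ∀ᵐ x, A' x = A x + B x) {φ : Space d → ℝ} (hφ : LocallyIntegrable φ)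
    (hgrad : IsWeakGradient φ B) {u v : L2 d} {g k : Fin d → L2 d}
    (h : HasMagneticGradient A u g) (hv : v =ᵐ[volume] fun x => phase φ x * u x)
    (hk : ∀ j, k j =ᵐ[volume] fun x => phase φ x * g j x) : HasMagneticGradient A' v k := by
  intro j χ hχ
  -- The smooth `φn n` may be used in the phase, and its gradient is the mollification of `B`.
  set φn : ℕ → Space d → ℝ := fun n => mollify (stdMollifier n) φ
  set Bn : ℕ → Space d → ℝ := fun n => mollify (stdMollifier n) fun x => B x j
  have hφn : ∀ n, ContDiff ℝ ∞ (φn n) := fun n => contDiff_mollify (isTest_stdMollifier n) hφ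
  have hφnm : ∀ n, AEStronglyMeasurable (φn n) volume :=
    fun n => (hφn n).continuous.aestronglyMeasurable
  have hlim : ∀ᵐ x, Tendsto (fun n => φn n x) atTop (𝓝 (φ x)) := ae_tendsto_mollify hφ
  have hBn : ∀ n, Continuous (Bn n) := fun n =>
    (contDiff_mollify (isTest_stdMollifier n) (hB j).locallyIntegrable).continuous
  set h₂ : Space d → ℂ := fun x => -(Complex.I * u x * (partialDeriv j χ x : ℂ)) +
    (A x j : ℂ) * u x * (χ x : ℂ)
  have hh₁ : Integrable fun x => g j x * (χ x : ℂ) :=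
    integrable_mul_test _ hχ.1.continuous hχ.2
  have hh₂ : Integrable h₂ := by
    refine Integrable.add ?_ ((hA.locallyL2 j).integrable_mul_mul_test u hχ.1.continuous hχ.2)
    have := (integrable_mul_test u (hχ.continuous_partialDeriv j)
      (hχ.hasCompactSupport_partialDeriv j)).const_mul (-Complex.I)
    refine this.congr (Eventually.of_forall fun x => ?_)
    simp only; ring
  have hh₃ : Integrable fun x => (B x j : ℂ) * u x * (χ x : ℂ) :=
    (hB j).integrable_mul_mul_test u hχ.1.continuous hχ.2
  have hh₄ : ∀ n, Integrable fun x => u x * ((χ x * Bn n x : ℝ) : ℂ) := fun n =>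
    integrable_mul_test u (hχ.1.continuous.mul (hBn n)) hχ.2.mul_right
  -- The error of replacing `Bn n` by `B`. The phases have modulus one, so it is at most `∫ |u χ|
  -- |Bn n - B|`, which tends to zero by `L²_loc` convergence.
  have hD : Tendsto (fun n => ∫ x, phase (φn n) x *
      (u x * ((χ x * Bn n x : ℝ) : ℂ) - (B x j : ℂ) * u x * (χ x : ℂ))) atTop (𝓝 0) := by
    obtain ⟨r, -, hr⟩ := exists_support_subset hχ
    have hum : Measurable fun x => ‖u x‖ * χ x :=
      (Lp.stronglyMeasurable u).measurable.norm.mul hχ.1.continuous.measurable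
    have hu2 : MemLp (fun x => ‖u x‖ * χ x) 2 volume := by
      obtain ⟨M, hM⟩ := hχ.1.continuous.bounded_above_of_compact_support hχ.2
      refine (Lp.memLp u).of_le_mul (c := M) hum.aestronglyMeasurable
        (Eventually.of_forall fun x => ?_)
      rw [norm_mul, norm_norm, mul_comm]
      exact mul_le_mul_of_nonneg_right (hM x) (norm_nonneg _)
    have hT := tendsto_lintegral_mul_mollify_sub (hBm j) (hB j) hum hu2 (r := r) fun x hx => by
      rw [image_eq_zero_of_notMem_tsupport fun h => hx (hr h), mul_zero]
    rw [tendsto_zero_iff_enorm_tendsto_zero]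
    refine tendsto_of_tendsto_of_tendsto_of_le_of_le tendsto_const_nhds hT (fun n => bot_le)
      fun n => (enorm_integral_le_lintegral_enorm _).trans (lintegral_mono fun x => ?_)
    have : phase (φn n) x * (u x * ((χ x * Bn n x : ℝ) : ℂ) - (B x j : ℂ) * u x * (χ x : ℂ)) =
        phase (φn n) x * (u x * ((χ x : ℝ) : ℂ) * ((Bn n x - B x j : ℝ) : ℂ)) := by
      push_cast; ring
    rw [this, enorm_mul, enorm_mul, enorm_mul, enorm_mul, enorm_norm]
    have h1 : ‖phase (φn n) x‖ₑ = 1 := by rw [← ofReal_norm, norm_phase, ENNReal.ofReal_one]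
    have h2 : ∀ t : ℝ, ‖(t : ℂ)‖ₑ = ‖t‖ₑ := fun t => by
      rw [← ofReal_norm, Complex.norm_real, ofReal_norm]
    rw [h1, h2, h2, one_mul]
  have hid : ∀ n, ∫ x, phase (φn n) x * (g j x * (χ x : ℂ)) =
      (∫ x, phase (φn n) x * h₂ x) +
      ((∫ x, phase (φn n) x * ((B x j : ℂ) * u x * (χ x : ℂ))) +
      ∫ x, phase (φn n) x * (u x * ((χ x * Bn n x : ℝ) : ℂ) - (B x j : ℂ) * u x * (χ x : ℂ))) := by
    intro n
    rw [h.integral_phase hA j hχ (hφn n)]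
    simp only [φn, hgrad.partialDeriv_mollify (isTest_stdMollifier n) hφ]
    rw [integral_add (integrable_phase_mul (hφnm n) hh₂) (integrable_phase_mul (hφnm n) (hh₄ n))]
    congr 1
    have hsum := integral_add (integrable_phase_mul (hφnm n) hh₃)
      (integrable_phase_mul (hφnm n) ((hh₄ n).sub hh₃))
    refine Eq.trans ?_ hsum
    refine integral_congr_ae (Eventually.of_forall fun x => ?_)
    simp only [Pi.sub_apply, Bn]
    ring
  have hLHS := tendsto_integral_phase_mul hφnm hlim hh₁
  have hRHS := (tendsto_integral_phase_mul hφnm hlim hh₂).add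
    ((tendsto_integral_phase_mul hφnm hlim hh₃).add hD)
  have key := tendsto_nhds_unique (hLHS.congr hid) hRHS
  have hφm := hφ.aestronglyMeasurable
  rw [add_zero, ← integral_add (integrable_phase_mul hφm hh₂) (integrable_phase_mul hφm hh₃)] at key
  calc ∫ x, k j x * (χ x : ℂ) = ∫ x, phase φ x * (g j x * (χ x : ℂ)) := by
        refine integral_congr_ae ?_
        filter_upwards [hk j] with x hx
        rw [hx, mul_assoc]
    _ = _ := by
        rw [key]
        refine integral_congr_ae ?_
        filter_upwards [hv, hAB] with x hx hx'
        simp only [h₂, hx, hx', PiLp.add_apply, Complex.ofReal_add]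
        ring

end MagneticGradient

/-! ### Energy shells and uniqueness of the scattering matrix. -/

noncomputable section ScatteringMatrix

variable {d : ℕ}

lemma ae_polar_of_ae {P : Space d → Prop} (h : ∀ᵐ ξ, P ξ) :
    ∀ᵐ r : ℝ ∂(volume.restrict (Set.Ioi 0)),
      ∀ᵐ θ : Metric.sphere (0 : Space d) 1 ∂(volume : Measure (Space d)).toSphere,
        P (r • (θ : Space d)) := by
  have hmp := (volume : Measure (Space d)).measurePreserving_homeomorphUnitSphereProd
  have h1 : ∀ᵐ y : ({0}ᶜ : Set (Space d)) ∂(volume.comap Subtype.val), P y :=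
    (ae_restrict_iff_subtype (measurableSet_singleton _).compl).1 (ae_restrict_of_ae h)
  have h2 : ∀ᵐ p ∂((volume : Measure (Space d)).toSphere.prod
      (Measure.volumeIoiPow (Module.finrank ℝ (Space d) - 1))),
      P (((homeomorphUnitSphereProd (Space d)).symm p : ({0}ᶜ : Set (Space d))) : Space d) := by
    have hs : MeasurePreserving (homeomorphUnitSphereProd (Space d)).symm
        ((volume : Measure (Space d)).toSphere.prod
          (Measure.volumeIoiPow (Module.finrank ℝ (Space d) - 1))) (volume.comap Subtype.val) :=
      MeasurePreserving.symm (homeomorphUnitSphereProd (Space d)).toMeasurableEquiv hmp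
    exact hs.quasiMeasurePreserving.ae h1
  have h3 := Measure.ae_ae_of_ae_prod (Measure.measurePreserving_swap.quasiMeasurePreserving.ae h2)
  -- The radial density `r^{d-1}` is positive on `r > 0`, so a statement valid almost everywhere for
  -- it is valid Lebesgue almost everywhere.
  rw [Measure.volumeIoiPow, ae_withDensity_iff (by fun_prop)] at h3
  refine (ae_restrict_iff_subtype measurableSet_Ioi).2 ?_
  filter_upwards [h3] with r hr
  have hr0 : (0 : ℝ) < r := r.2
  have := hr (by simpa using pow_pos hr0 _)
  filter_upwards [this] with θ hθ
  simpa using hθ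

/-- The inverse change of variables `r ↦ (2πr)²` is differentiable and so maps null sets to null
sets. -/
lemma ae_energy_of_ae {Q : ℝ → Prop} (h : ∀ᵐ r : ℝ ∂(volume.restrict (Set.Ioi 0)), Q r) :
    ∀ᵐ E : ℝ ∂(volume.restrict (Set.Ioi 0)), Q ((2 * Real.pi)⁻¹ * Real.sqrt E) := by
  rw [ae_restrict_iff' measurableSet_Ioi, ae_iff] at h ⊢
  have h1 := addHaar_image_eq_zero_of_differentiableOn_of_addHaar_eq_zero
    (f := fun r : ℝ => (2 * Real.pi * r) ^ 2) volume (by fun_prop) h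
  refine measure_mono_null (fun E hE => ?_) h1
  simp only [Set.mem_Ioi, Classical.not_imp, Set.mem_ofPred_eq] at hE
  refine ⟨(2 * Real.pi)⁻¹ * Real.sqrt E, ?_, ?_⟩
  · simp only [Set.mem_Ioi, Classical.not_imp, Set.mem_ofPred_eq]
    exact ⟨by have := Real.sqrt_pos.2 hE.1; positivity, hE.2⟩
  · have : 2 * Real.pi * ((2 * Real.pi)⁻¹ * Real.sqrt E) = Real.sqrt E := by
      field_simp
    simp only [this]
    exact Real.sq_sqrt hE.1.le

/-- For every `g ∈ L²(𝕊^{d-1})` there is a function of `L²(ℝ^d)` whose restrictions to the energy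
shells in a bounded range of energies are multiples of `g`. -/
lemma exists_energyShell_eq (hd : 0 < d) (g : L2Sphere d) (m : ℕ) :
    ∃ f : L2 d, ∀ᵐ E : ℝ ∂(volume.restrict (Set.Ioi 0)), (2 * Real.pi)⁻¹ * Real.sqrt E < m →
      ∃ c : ℂ, c ≠ 0 ∧
        energyShell f E =ᵐ[(volume : Measure (Space d)).toSphere] fun θ => c * g θ := by
  have : Nonempty (Fin d) := ⟨⟨0, hd⟩⟩
  set μ := (volume : Measure (Space d)).toSphere
  set ν := Measure.volumeIoiPow (Module.finrank ℝ (Space d) - 1)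
  -- The radial cutoff makes `g(θ) w(r)` square integrable; any bounded range of energies is reached
  -- for `m` large.
  set w : Set.Ioi (0 : ℝ) → ℂ := fun r => if (r : ℝ) < m then 1 else 0
  have hw : Measurable w :=
    Measurable.ite (measurableSet_lt measurable_subtype_coe measurable_const) measurable_const
      measurable_const
  have hwint : Integrable (fun r => ‖w r‖ ^ 2) ν := by
    have hfin : ν {r | (r : ℝ) < m} < ⊤ := by
      refine (measure_mono (t := Set.Iio ⟨(m : ℝ) + 1, Set.mem_Ioi.2 m.cast_add_one_pos⟩) fun r hr => ?_).trans_lt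
        (by rw [Measure.volumeIoiPow_apply_Iio]; exact ENNReal.ofReal_lt_top)
      change (r : ℝ) < m + 1
      have : (r : ℝ) < m := hr
      linarith
    have h1 : IntegrableOn (fun _ => (1 : ℝ)) {r : Set.Ioi (0 : ℝ) | (r : ℝ) < m} ν :=
      integrableOn_const hfin.ne
    rw [← integrable_indicator_iff (measurableSet_lt measurable_subtype_coe measurable_const)] at h1
    refine h1.congr (Eventually.of_forall fun r => ?_)
    by_cases hr : (r : ℝ) < m <;> simp [w, hr]
  set G : Metric.sphere (0 : Space d) 1 × Set.Ioi (0 : ℝ) → ℂ := fun p => g p.1 * w p.2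
  have hG : MemLp G 2 (μ.prod ν) := by
    have hm : AEStronglyMeasurable G (μ.prod ν) :=
      ((Lp.stronglyMeasurable g).comp_measurable measurable_fst).aestronglyMeasurable.mul
        (hw.comp measurable_snd).aestronglyMeasurable
    rw [memLp_two_iff_integrable_sq_norm hm]
    have h1 : Integrable (fun θ => ‖g θ‖ ^ 2) μ :=
      (memLp_two_iff_integrable_sq_norm (Lp.memLp g).1).1 (Lp.memLp g)
    refine (h1.mul_prod hwint).congr (Eventually.of_forall fun p => ?_)
    simp only [G, norm_mul, mul_pow]
  have hmp := (volume : Measure (Space d)).measurePreserving_homeomorphUnitSphereProd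
  have hemb : MeasurableEmbedding (Subtype.val : ({0}ᶜ : Set (Space d)) → Space d) :=
    MeasurableEmbedding.subtype_coe (measurableSet_singleton _).compl
  set F : Space d → ℂ := Function.extend Subtype.val
    (G ∘ homeomorphUnitSphereProd (Space d)) 0
  have hF : ∀ y : ({0}ᶜ : Set (Space d)), F y = G (homeomorphUnitSphereProd (Space d) y) :=
    fun y => Subtype.val_injective.extend_apply _ _ y
  have hFL : MemLp F 2 (volume : Measure (Space d)) := by
    have h1 : MemLp (F ∘ Subtype.val) 2
        ((volume : Measure (Space d)).comap (Subtype.val : ({0}ᶜ : Set (Space d)) → Space d)) := by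
      have : F ∘ Subtype.val = G ∘ homeomorphUnitSphereProd (Space d) := funext hF
      rw [this]
      exact hG.comp_measurePreserving hmp
    rw [← hemb.memLp_map_measure_iff, map_comap_subtype_coe (measurableSet_singleton _).compl,
      restrict_compl_singleton] at h1
    exact h1
  have hae : ∀ᵐ ξ, (𝓕 (𝓕⁻ (hFL.toLp F)) : L2 d) ξ = F ξ := by
    rw [FourierTransform.fourier_fourierInv_eq]
    exact hFL.coeFn_toLp
  refine ⟨𝓕⁻ (hFL.toLp F), ?_⟩
  filter_upwards [ae_energy_of_ae (ae_polar_of_ae hae), ae_restrict_mem measurableSet_Ioi]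
    with E hE hE0 hEm
  have hE0' : 0 < E := hE0
  have hs := Real.sqrt_pos.2 hE0'
  have hr : 0 < (2 * Real.pi)⁻¹ * Real.sqrt E := by positivity
  refine ⟨(((2 : ℝ) ^ (-(1 / 2) : ℝ) * E ^ (((d : ℝ) - 2) / 4) : ℝ) : ℂ) *
    (((2 * Real.pi) ^ (-(d : ℝ) / 2) : ℝ) : ℂ), ?_, ?_⟩
  · have h1 : 0 < (2 : ℝ) ^ (-(1 / 2) : ℝ) * E ^ (((d : ℝ) - 2) / 4) := by positivity
    have h2 : 0 < (2 * Real.pi) ^ (-(d : ℝ) / 2) := by positivity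
    exact mul_ne_zero (Complex.ofReal_ne_zero.2 h1.ne') (Complex.ofReal_ne_zero.2 h2.ne')
  · filter_upwards [hE] with θ hθ
    rw [energyShell, fourierHat, smul_smul, hθ]
    have h1 : F (((2 * Real.pi)⁻¹ * Real.sqrt E) • (θ : Space d)) = g θ := by
      have h2 : ((2 * Real.pi)⁻¹ * Real.sqrt E) • (θ : Space d) =
          ((homeomorphUnitSphereProd (Space d)).symm (θ, ⟨_, hr⟩) : ({0}ᶜ : Set (Space d))) := by
        simp
      rw [h2, hF, Homeomorph.apply_symm_apply]
      simp only [G, w, if_pos hEm, mul_one]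
    rw [h1, mul_assoc]

/-- The scattering matrix is determined by the scattering operator. -/
theorem ae_eq_of_energyShell (hd : 0 < d) {S : L2 d →L[ℂ] L2 d}
    {M M' : ℝ → L2Sphere d →L[ℂ] L2Sphere d}
    (hM : ∀ f : L2 d, ∀ᵐ E : ℝ ∂(volume.restrict (Set.Ioi 0)),
      ∃ h : MemLp (energyShell f E) 2 (volume : Measure (Space d)).toSphere,
        M E (h.toLp (energyShell f E)) =ᵐ[(volume : Measure (Space d)).toSphere]
          energyShell (S f) E)
    (hM' : ∀ f : L2 d, ∀ᵐ E : ℝ ∂(volume.restrict (Set.Ioi 0)),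
      ∃ h : MemLp (energyShell f E) 2 (volume : Measure (Space d)).toSphere,
        M' E (h.toLp (energyShell f E)) =ᵐ[(volume : Measure (Space d)).toSphere]
          energyShell (S f) E) :
    ∀ᵐ E : ℝ ∂(volume.restrict (Set.Ioi 0)), M' E = M E := by
  have : Fact ((2 : ENNReal) ≠ ⊤) := ⟨by simp⟩
  have : MeasurableSpace.CountablyGenerated (Metric.sphere (0 : Space d) 1) := inferInstance
  have : SecondCountableTopology (L2Sphere d) := Lp.SecondCountableTopology
  -- Each `f` excludes a null set of energies, so only countably many may be used: one for each
  -- member of a dense sequence and each cutoff `m`.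
  set g : ℕ → L2Sphere d := TopologicalSpace.denseSeq (L2Sphere d)
  choose f hf using fun n m => exists_energyShell_eq hd (g n) m
  have h1 := ae_all_iff.2 fun n => ae_all_iff.2 fun m => hf n m
  have h2 := ae_all_iff.2 fun n => ae_all_iff.2 fun m => hM (f n m)
  have h3 := ae_all_iff.2 fun n => ae_all_iff.2 fun m => hM' (f n m)
  filter_upwards [h1, h2, h3] with E h1 h2 h3
  obtain ⟨m, hm⟩ := exists_nat_gt ((2 * Real.pi)⁻¹ * Real.sqrt E)
  have key : ∀ n, M' E (g n) = M E (g n) := by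
    intro n
    obtain ⟨c, hc, hcg⟩ := h1 n m hm
    obtain ⟨h, hME⟩ := h2 n m
    obtain ⟨h', hME'⟩ := h3 n m
    have e1 : h.toLp (energyShell (f n m) E) = c • g n := by
      refine Lp.ext ?_
      filter_upwards [h.coeFn_toLp, Lp.coeFn_smul c (g n), hcg] with θ a1 a2 a3
      rw [a1, a2, a3]; rfl
    have e2 : M' E (h'.toLp (energyShell (f n m) E)) = M E (h.toLp (energyShell (f n m) E)) :=
      Lp.ext (hME'.trans hME.symm)
    rw [e1, map_smul, map_smul] at e2
    exact smul_right_injective _ hc e2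
  exact DFunLike.coe_injective <|
    (TopologicalSpace.denseRange_denseSeq (L2Sphere d)).equalizer (M' E).continuous (M E).continuous
      (funext key)

end ScatteringMatrix

/-! ### The gauge transformation and its effect on wave operators. -/

noncomputable section GaugeTransformation

variable {d : ℕ}

lemma memLp_phase_mul {φ : Space d → ℝ} (hφ : AEStronglyMeasurable φ volume) (u : L2 d) :
    MemLp (fun x => phase φ x * u x) 2 volume :=
  (Lp.memLp u).of_le ((aestronglyMeasurable_phase hφ).mul (Lp.memLp u).1)
    (Eventually.of_forall fun x => by rw [norm_mul, norm_phase, one_mul])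

lemma phase_neg_mul_phase (φ : Space d → ℝ) (x : Space d) : phase (-φ) x * phase φ x = 1 := by
  rw [phase, phase, ← Complex.exp_add]; simp

/-- Multiplication by `e^{iφ}` as a unitary operator in `L²`. -/
def gaugeEquiv (φ : Space d → ℝ) (hφ : AEStronglyMeasurable φ volume) : L2 d ≃ₗᵢ[ℂ] L2 d where
  toFun u := (memLp_phase_mul hφ u).toLp _
  invFun u := (memLp_phase_mul hφ.neg u).toLp _
  map_add' u v := by
    refine Lp.ext ?_
    filter_upwards [(memLp_phase_mul hφ (u + v)).coeFn_toLp, (memLp_phase_mul hφ u).coeFn_toLp,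
      (memLp_phase_mul hφ v).coeFn_toLp, Lp.coeFn_add u v,
      Lp.coeFn_add ((memLp_phase_mul hφ u).toLp _) ((memLp_phase_mul hφ v).toLp _)]
      with x h1 h2 h3 h4 h5
    rw [h1, h5, Pi.add_apply, h2, h3, h4, Pi.add_apply, mul_add]
  map_smul' c u := by
    refine Lp.ext ?_
    filter_upwards [(memLp_phase_mul hφ (c • u)).coeFn_toLp, (memLp_phase_mul hφ u).coeFn_toLp,
      Lp.coeFn_smul c u, Lp.coeFn_smul c ((memLp_phase_mul hφ u).toLp _)] with x h1 h2 h3 h4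
    rw [h1, RingHom.id_apply, h4, Pi.smul_apply, h2, h3, Pi.smul_apply, smul_eq_mul, smul_eq_mul,
      mul_left_comm]
  left_inv u := by
    refine Lp.ext ?_
    filter_upwards [(memLp_phase_mul hφ u).coeFn_toLp,
      (memLp_phase_mul hφ.neg ((memLp_phase_mul hφ u).toLp _)).coeFn_toLp] with x h1 h2
    rw [h2, h1, ← mul_assoc, phase_neg_mul_phase, one_mul]
  right_inv u := by
    refine Lp.ext ?_
    filter_upwards [(memLp_phase_mul hφ.neg u).coeFn_toLp,
      (memLp_phase_mul hφ ((memLp_phase_mul hφ.neg u).toLp _)).coeFn_toLp] with x h1 h2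
    rw [h2, h1, ← mul_assoc, mul_comm (phase φ x), phase_neg_mul_phase, one_mul]
  norm_map' u := by
    change ‖(memLp_phase_mul hφ u).toLp _‖ = ‖u‖
    rw [Lp.norm_toLp, Lp.norm_def]
    congr 1
    exact eLpNorm_congr_norm_ae (Eventually.of_forall fun x => by
      rw [norm_mul, norm_phase, one_mul])

lemma coeFn_gaugeEquiv (φ : Space d → ℝ) (hφ : AEStronglyMeasurable φ volume) (u : L2 d) :
    gaugeEquiv φ hφ u =ᵐ[volume] fun x => phase φ x * u x :=
  (memLp_phase_mul hφ u).coeFn_toLp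

lemma coeFn_gaugeEquiv_symm (φ : Space d → ℝ) (hφ : AEStronglyMeasurable φ volume) (u : L2 d) :
    (gaugeEquiv φ hφ).symm u =ᵐ[volume] fun x => phase (-φ) x * u x :=
  (memLp_phase_mul hφ.neg u).coeFn_toLp

lemma LocallyL2.neg {f : Space d → ℝ} (hf : LocallyL2 f) : LocallyL2 fun x => -f x :=
  fun K hK => (hf K hK).neg

lemma IsWeakGradient.neg {φ : Space d → ℝ} {B : Space d → Space d} (h : IsWeakGradient φ B) :
    IsWeakGradient (-φ) fun x => -B x := by
  intro j χ hχ
  have := h j χ hχ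
  simp only [Pi.neg_apply, PiLp.neg_apply, neg_mul, integral_neg, this]

/-- Hamiltonians whose magnetic potentials differ by a gradient are unitarily equivalent. -/
theorem magneticHamiltonian_gauge {A A' B : Space d → Space d} (hA : LocallySquareIntegrable A)
    (hA' : LocallySquareIntegrable A') (hB : ∀ j, LocallyL2 fun x => B x j)
    (hBm : ∀ j, Measurable fun x => B x j) (hAB : ∀ᵐ x, A' x = A x + B x) {φ : Space d → ℝ}
    (hφ : LocallyIntegrable φ) (hgrad : IsWeakGradient φ B) (u f : L2 d) :
    magneticHamiltonian A u f ↔ magneticHamiltonian A' (gaugeEquiv φ hφ.aestronglyMeasurable u)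
      (gaugeEquiv φ hφ.aestronglyMeasurable f) := by
  set G := gaugeEquiv φ hφ.aestronglyMeasurable
  have hG : ∀ u : L2 d, G u =ᵐ[volume] fun x => phase φ x * u x :=
    coeFn_gaugeEquiv φ hφ.aestronglyMeasurable
  have hG' : ∀ u : L2 d, G.symm u =ᵐ[volume] fun x => phase (-φ) x * u x :=
    coeFn_gaugeEquiv_symm φ hφ.aestronglyMeasurable
  have h1 : ∀ {u g}, HasMagneticGradient A u g → HasMagneticGradient A' (G u) fun j => G (g j) :=
    fun h => h.gauge hA hB hBm hAB hφ hgrad (hG _) fun j => hG _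
  have h2 : ∀ {u g}, HasMagneticGradient A' u g →
      HasMagneticGradient A (G.symm u) fun j => G.symm (g j) := fun h =>
    h.gauge hA' (B := fun x => -B x) (fun j => (hB j).neg) (fun j => (hBm j).neg)
      (by filter_upwards [hAB] with x hx; rw [hx]; abel) hφ.neg hgrad.neg (hG' _) fun j => hG' _
  constructor
  · rintro ⟨g, hg, hform⟩
    refine ⟨fun j => G (g j), h1 hg, fun v k hk => ?_⟩
    -- Elements of the form domain of `A'` are pulled back by `G⁻¹`; unitarity of `G` then
    -- transports the form identity.
    have := hform _ _ (h2 hk)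
    calc ∑ j, ⟪k j, G (g j)⟫_ℂ = ∑ j, ⟪G.symm (k j), g j⟫_ℂ :=
          Finset.sum_congr rfl fun j _ => by rw [← G.inner_map_map (G.symm (k j)), G.apply_symm_apply]
      _ = ⟪G.symm v, f⟫_ℂ := this
      _ = _ := by rw [← G.inner_map_map (G.symm v), G.apply_symm_apply]
  · rintro ⟨g, hg, hform⟩
    refine ⟨fun j => G.symm (g j), by simpa using h2 hg, fun v k hk => ?_⟩
    have := hform _ _ (h1 hk)
    calc ∑ j, ⟪k j, G.symm (g j)⟫_ℂ = ∑ j, ⟪G (k j), g j⟫_ℂ :=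
          Finset.sum_congr rfl fun j _ => by rw [← G.inner_map_map (k j), G.apply_symm_apply]
      _ = ⟪G v, G f⟫_ℂ := this
      _ = _ := G.inner_map_map _ _

/-- The difference of the potentials, corrected on a null set. -/
lemma exists_shortRange_difference {A A' : Space d → Space d} (hA : LocallySquareIntegrable A)
    (hA' : LocallySquareIntegrable A') {ρ : ℝ}
    (hdecay : ∃ C R : ℝ, ∀ᵐ x, R ≤ ‖x‖ → ‖A' x - A x‖ ≤ C * ‖x‖ ^ (-ρ)) :
    ∃ (B : Space d → Space d) (C R : ℝ), (∀ᵐ x, A' x = A x + B x) ∧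
      (∀ j, LocallyL2 fun x => B x j) ∧ ∀ j, IsShortRange (fun x => B x j) C R ρ := by
  obtain ⟨C, R, hCR⟩ := hdecay
  have hD : LocallySquareIntegrable fun x => A' x - A x := fun K hK => (hA' K hK).sub (hA K hK)
  have hDloc : LocallyIntegrable fun x => A' x - A x := by
    rw [locallyIntegrable_iff]
    intro K hK
    have : IsFiniteMeasure (volume.restrict K) := ⟨by simpa using hK.measure_lt_top⟩
    exact (hD K hK).integrable one_le_two
  obtain ⟨D, hDm, hDae⟩ := hDloc.aestronglyMeasurable
  -- The ray integrals need a measurable field bounded at every point, so a measurable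
  -- representative is set to zero wherever the decay bound fails.
  set s : Set (Space d) := {x | R ≤ ‖x‖ → ‖D x‖ ≤ C * ‖x‖ ^ (-ρ)} with hs_def
  have hs : MeasurableSet s := by
    have h1 : MeasurableSet {x : Space d | R ≤ ‖x‖} :=
      measurableSet_le measurable_const measurable_norm
    have h2 : MeasurableSet {x : Space d | ‖D x‖ ≤ C * ‖x‖ ^ (-ρ)} :=
      measurableSet_le hDm.measurable.norm ((measurable_norm.pow_const _).const_mul C)
    exact h1.imp h2
  have hsae : ∀ᵐ x, x ∈ s := by
    filter_upwards [hCR, hDae] with x hx hx'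
    change R ≤ ‖x‖ → ‖D x‖ ≤ C * ‖x‖ ^ (-ρ)
    rwa [← hx']
  have hBae : ∀ᵐ x, s.indicator D x = A' x - A x := by
    filter_upwards [hsae, hDae] with x hx hx'
    rw [Set.indicator_of_mem hx, ← hx']
  have hBm : ∀ j : Fin d, Measurable fun x => s.indicator D x j := fun j =>
    (EuclideanSpace.proj (𝕜 := ℝ) j).continuous.measurable.comp (hDm.measurable.indicator hs)
  have hBL : ∀ j : Fin d, LocallyL2 fun x => s.indicator D x j := fun j K hK =>
    (memLp_congr_ae (ae_restrict_of_ae (by filter_upwards [hBae] with x hx; rw [hx]))).1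
      (hD.locallyL2 j K hK)
  refine ⟨s.indicator D, |C|, max R 1, ?_, hBL, fun j => ⟨hBm j, (hBL j).locallyIntegrable,
    le_max_right _ _, abs_nonneg C, fun x hx => ?_⟩⟩
  · filter_upwards [hBae] with x hx
    rw [hx]; abel
  · have hpow : 0 ≤ ‖x‖ ^ (-ρ) := Real.rpow_nonneg (norm_nonneg _) _
    refine (PiLp.norm_apply_le (s.indicator D x) j).trans ?_
    by_cases hxs : x ∈ s
    · rw [Set.indicator_of_mem hxs]
      exact (hxs ((le_max_left _ _).trans hx)).trans
        (mul_le_mul_of_nonneg_right (le_abs_self C) hpow)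
    · rw [Set.indicator_of_notMem hxs, norm_zero]
      positivity

lemma SameCurl.integral_difference {A A' B : Space d → Space d} (hcurl : SameCurl A A')
    (hA : LocallySquareIntegrable A) (hB : ∀ j, LocallyL2 fun x => B x j)
    (hAB : ∀ᵐ x, A' x = A x + B x) (j k : Fin d) (χ : Space d → ℝ) (hχ : IsTest χ) :
    ∫ x, B x k * partialDeriv j χ x = ∫ x, B x j * partialDeriv k χ x := by
  have hi : ∀ {f : Space d → ℝ}, LocallyL2 f → ∀ i, Integrable fun x => f x * partialDeriv i χ x :=
    fun hf i => integrable_mul_of_hasCompactSupport hf.locallyIntegrable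
      (hχ.continuous_partialDeriv i) (hχ.hasCompactSupport_partialDeriv i)
  have h1 : ∫ x, (A' x k * partialDeriv j χ x - A' x j * partialDeriv k χ x) =
      ∫ x, ((A x k * partialDeriv j χ x - A x j * partialDeriv k χ x) +
        (B x k * partialDeriv j χ x - B x j * partialDeriv k χ x)) := by
    refine integral_congr_ae ?_
    filter_upwards [hAB] with x hx
    simp only [hx, PiLp.add_apply]; ring
  have h2 := hcurl j k χ hχ
  have h3 := integral_add ((hi (hA.locallyL2 k) j).sub (hi (hA.locallyL2 j) k))
    ((hi (hB k) j).sub (hi (hB j) k))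
  have h4 := integral_sub (hi (hB k) j) (hi (hB j) k)
  have h5 := (h2.trans h1).trans h3
  simp only [Pi.sub_apply] at h5
  linarith

/-- Wave operators under a change of the potential within the class of short-range potentials with
the same magnetic field. -/
theorem exists_gauge_waveOperator {A A' : Space d → Space d} (hd : 2 ≤ d)
    (hA : LocallySquareIntegrable A) (hA' : LocallySquareIntegrable A') (hcurl : SameCurl A A')
    {ρ : ℝ} (hρ : 1 < ρ)
    (hdecay : ∃ C R : ℝ, ∀ᵐ x, R ≤ ‖x‖ → ‖A' x - A x‖ ≤ C * ‖x‖ ^ (-ρ)) :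
    ∃ G : L2 d ≃ₗᵢ[ℂ] L2 d, ∀ l : Filter ℝ, Tendsto (fun t => |t|) l atTop → ∀ W,
      IsWaveOperator l (magneticHamiltonian A) (freeHamiltonian d) W →
      IsWaveOperator l (magneticHamiltonian A') (freeHamiltonian d) ((G : L2 d →L[ℂ] L2 d) * W) := by
  obtain ⟨B, C, R, hAB, hBL, hB⟩ := exists_shortRange_difference hA hA' hdecay
  obtain ⟨φ, hφ, hgrad, hφ0⟩ := exists_isWeakGradient hd hρ hB
    (hcurl.integral_difference hA hBL hAB)
  have hφm := hφ.aestronglyMeasurable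
  refine ⟨gaugeEquiv φ hφm, fun l hl W hW => hW.conj _
    (magneticHamiltonian_gauge hA hA' hBL (fun j => (hB j).measurable) hAB hφ hgrad) ?_⟩
  intro U₀ hU f
  -- The wave operator involves `U₀ (-t)`, so local decay is applied along the reflected filter; it
  -- depends on `|t|` alone.
  have hl' : Tendsto (fun t => |t|) (l.map fun t => -t) atTop := by
    rw [tendsto_map'_iff]
    simpa [Function.comp_def] using hl
  have key := tendsto_mul_freeEvolution ⟨0, by omega⟩ hU
    (((gaugeEquiv φ hφm).symm : L2 d →L[ℂ] L2 d) - 1) (θ := fun x => phase (-φ) x - 1)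
    ?_ ?_ ?_ hl' f
  · rw [tendsto_map'_iff] at key
    exact key
  · intro u
    filter_upwards [Lp.coeFn_sub ((gaugeEquiv φ hφm).symm u) u, coeFn_gaugeEquiv_symm φ hφm u]
      with x h1 h2
    change ((gaugeEquiv φ hφm).symm u - u : L2 d) x = _
    rw [h1, Pi.sub_apply, h2, sub_mul, one_mul]
  · intro x
    refine (norm_sub_le _ _).trans ?_
    rw [norm_phase, norm_one]; norm_num
  · intro ε hε
    obtain ⟨r, hr⟩ := hφ0 ε hε
    refine ⟨r, ?_⟩
    filter_upwards [hr] with x hx hxr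
    -- The bound `|e^{-iφ} - 1| ≤ |φ|` transfers the decay of `φ` to the multiplier.
    have h1 := Real.norm_exp_I_mul_ofReal_sub_one_le (x := -φ x)
    rw [mul_comm, norm_neg, Real.norm_eq_abs] at h1
    exact h1.trans (hx hxr)

lemma SameCurl.symm {A A' : Space d → Space d} (h : SameCurl A A') : SameCurl A' A :=
  fun j k φ hφ => (h j k φ hφ).symm

/-- It is essential that a single `G` serves both filters: with different unitaries at `±∞` nothing
would cancel. -/
lemma IsScatteringOperator.of_gauge {H H' H₀ : L2 d → L2 d → Prop} {S : L2 d →L[ℂ] L2 d}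
    (hS : IsScatteringOperator H H₀ S)
    (hG : ∃ G : L2 d ≃ₗᵢ[ℂ] L2 d, ∀ l : Filter ℝ, Tendsto (fun t => |t|) l atTop → ∀ W,
      IsWaveOperator l H H₀ W → IsWaveOperator l H' H₀ ((G : L2 d →L[ℂ] L2 d) * W)) :
    IsScatteringOperator H' H₀ S := by
  obtain ⟨G, hG⟩ := hG
  obtain ⟨Wp, Wm, hp, hm, rfl⟩ := hS
  exact ⟨_, _, hG _ tendsto_abs_atTop_atTop _ hp, hG _ tendsto_abs_atBot_atTop _ hm,
    (adjoint_comp_conj G Wp Wm).symm⟩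

lemma IsScatteringOperator.eq {H H₀ : L2 d → L2 d → Prop} {S S' : L2 d →L[ℂ] L2 d}
    (hS : IsScatteringOperator H H₀ S) (hS' : IsScatteringOperator H H₀ S') : S = S' := by
  obtain ⟨Wp, Wm, hp, hm, rfl⟩ := hS
  obtain ⟨Wp', Wm', hp', hm', rfl⟩ := hS'
  rw [hp.eq hp', hm.eq hm']

end GaugeTransformation

end MagneticScattering

/-! ### The main theorem. -/

theorem mainTheorem10 (d : ℕ) (hd : 2 ≤ d)
    (A A' : MagneticScattering.Space d → MagneticScattering.Space d)
    (hA : MagneticScattering.LocallySquareIntegrable A)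
    (hA' : MagneticScattering.LocallySquareIntegrable A')
    (hcurl : MagneticScattering.SameCurl A A')
    (ρ : ℝ) (hρ : 1 < ρ)
    (hdecay : ∃ C R : ℝ, ∀ᵐ x : MagneticScattering.Space d, R ≤ ‖x‖ →
      ‖A' x - A x‖ ≤ C * ‖x‖ ^ (-ρ))
    (hW : MagneticScattering.WaveOperatorsExist
      (MagneticScattering.magneticHamiltonian A) (MagneticScattering.freeHamiltonian d)) :
    MagneticScattering.WaveOperatorsExist
      (MagneticScattering.magneticHamiltonian A') (MagneticScattering.freeHamiltonian d) ∧
    (∀ S S' : MagneticScattering.L2 d →L[ℂ] MagneticScattering.L2 d,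
      MagneticScattering.IsScatteringOperator (MagneticScattering.magneticHamiltonian A)
        (MagneticScattering.freeHamiltonian d) S →
      MagneticScattering.IsScatteringOperator (MagneticScattering.magneticHamiltonian A')
        (MagneticScattering.freeHamiltonian d) S' →
      S' = S) ∧
    (∀ M : ℝ → MagneticScattering.L2Sphere d →L[ℂ] MagneticScattering.L2Sphere d,
      MagneticScattering.IsScatteringMatrix (MagneticScattering.magneticHamiltonian A) M ↔
        MagneticScattering.IsScatteringMatrix (MagneticScattering.magneticHamiltonian A') M) ∧
    (∀ M M' : ℝ → MagneticScattering.L2Sphere d →L[ℂ] MagneticScattering.L2Sphere d,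
      MagneticScattering.IsScatteringMatrix (MagneticScattering.magneticHamiltonian A) M →
      MagneticScattering.IsScatteringMatrix (MagneticScattering.magneticHamiltonian A') M' →
      ∀ᵐ E : ℝ ∂(MeasureTheory.volume.restrict (Set.Ioi 0)), M' E = M E) := by
  have hdecay' : ∃ C R : ℝ, ∀ᵐ x : MagneticScattering.Space d, R ≤ ‖x‖ →
      ‖A x - A' x‖ ≤ C * ‖x‖ ^ (-ρ) := by
    simpa only [norm_sub_rev] using hdecay
  have hG := MagneticScattering.exists_gauge_waveOperator hd hA hA' hcurl hρ hdecay
  -- The hypotheses are symmetric in the two potentials; the reversed gauge gives the converse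
  -- implication for scattering matrices.
  have hG' := MagneticScattering.exists_gauge_waveOperator hd hA' hA hcurl.symm hρ hdecay'
  refine ⟨?_, fun S S' hS hS' => hS'.eq (hS.of_gauge hG), fun M => ⟨?_, ?_⟩, ?_⟩
  · obtain ⟨G, hG⟩ := hG
    obtain ⟨⟨Wp, hp⟩, ⟨Wm, hm⟩⟩ := hW
    exact ⟨⟨_, hG _ tendsto_abs_atTop_atTop _ hp⟩, ⟨_, hG _ tendsto_abs_atBot_atTop _ hm⟩⟩
  · rintro ⟨S, hS, hM⟩
    exact ⟨S, hS.of_gauge hG, hM⟩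
  · rintro ⟨S, hS, hM⟩
    exact ⟨S, hS.of_gauge hG', hM⟩
  · rintro M M' ⟨S, hS, hM⟩ ⟨S', hS', hM'⟩
    -- Both families now represent one and the same scattering operator, which determines them
    -- almost everywhere.
    obtain rfl := hS'.eq (hS.of_gauge hG)
    exact MagneticScattering.ae_eq_of_energyShell (by omega) hM hM'
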